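/- Let $n\ge 2$ and let $M=SU(n+2)/S(U(n)\times U(2))$, with its standard smooth structure (that of the Grassmannian of complex $2$-planes in $\mathbb C^{n+2}$), so $\dim_{\mathbb R}M=4n\ge 8$. At the base point $o$ the tangent space is the space $\mathfrak m$ of complex $n\times 2$ matrices $X$, on which $(B,A)\in S(U(n)\times U(2))$ acts by $X\mapsto BXA^{-1}$. Let $\mathcal Q\subset L(TM,TM)$ be the $SU(n+2)$-invariant family of subspaces whose value at $o$ is $\{X\mapsto XS: S\in\mathfrak{su}(2)\}$; equivalently, $\mathcal Q_{kH}$ (with $H=S(U(n)\times U(2))$) is the real span of the differentials at $kH$ of the actions of the elements $k\,\mathrm{diag}(1_n,S)\,k^{-1}$, where $S\in SU(2)$, $S^2=-1$. Then: (a) $\mathcal Q$ is an $SU(n+2)$-invariant almost quaternionic structure on $M$: around each point it is spanned by three smooth almost complex structures $I,J,K$ with $IJ=K=-JI$. (b) There is an $SU(n+2)$-invariant Kähler structure $(g,J)$ on $M$, that is, an invariant Riemannian metric $g$ and an invariant integrable almost complex structure $J$ such that $g$ is Hermitian with respect to $J$ and the fundamental form $\omega(\xi,\eta)=-g(\xi,J\eta)$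 is closed. (c) For every $SU(n+2)$-invariant Kähler structure $(g,J)$ on $M$, with Kähler form $\omega$, the line bundle $\ell=\mathbb R\,\omega\subset\Lambda^2T^*M$ together with $\mathcal Q$ is a parabolic conformally symplectic (PCS) structure of quaternionic type on $M$. This means: $\mathcal Q$ is an almost quaternionic structure; $\ell$ is a smooth line subbundle of $\Lambda^2T^*M$ all of whose non-zero elements are non-degenerate; around each point $x$ there is a closed smooth local section of $\ell$ which is non-zero at $x$; and for each $x\in M$ every non-zero element of $\ell_x$ is the real part of a quaternionically skew-Hermitian form on $T_xM$ with respect to $\mathcal Q_x$, i.e. there are a right $\mathbb H$-module structure on $T_xM$, for which the multiplications by imaginary quaternions form $\mathcal Q_x$, and a real bilinear map $b:T_xM\times T_xM\to\mathbb H$ with $b(vq,w)=\bar q\,b(v,w)$, $b(v,wq)=b(v,w)q$ and $b(w,v)=-\overline{b(v,w)}$, whose real part is the given element. -/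

import Mathlib

open scoped Manifold ContDiff Quaternion
open Bundle

namespace QuatPCS

section General

/-- Two-forms on `M`: alternating bilinear forms on all tangent spaces (no regularity yet). -/
abbrev TwoForm (E : Type*) [NormedAddCommGroup E] [NormedSpace ℝ E]
    (M : Type*) [TopologicalSpace M] [ChartedSpace E M] : Type _ :=
  (x : M) → TangentSpace 𝓘(ℝ, E) x [⋀^Fin 2]→L[ℝ] ℝ

/-- Fields of endomorphisms of the tangent spaces of `M` (no regularity yet). -/
abbrev EndField (E : Type*) [NormedAddCommGroup E] [NormedSpace ℝ E]
    (M : Type*) [TopologicalSpace M] [ChartedSpace E M] : Type _ :=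
  (x : M) → TangentSpace 𝓘(ℝ, E) x →L[ℝ] TangentSpace 𝓘(ℝ, E) x

variable {E : Type*} [NormedAddCommGroup E] [NormedSpace ℝ E]
  {M : Type*} [TopologicalSpace M] [ChartedSpace E M]

/-- The coordinate expression of a two-form in the preferred chart around `x₀`, that is, its
pullback along the inverse of that chart. -/
noncomputable def TwoForm.inChart (τ : TwoForm E M) (x₀ : M) (y : E) : E [⋀^Fin 2]→L[ℝ] ℝ :=
  (τ ((extChartAt 𝓘(ℝ, E) x₀).symm y)).compContinuousLinearMap
    (mfderiv 𝓘(ℝ, E) 𝓘(ℝ, E) (extChartAt 𝓘(ℝ, E) x₀).symm y)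

/-- A two-form is smooth at `x` if its coefficients in the chart around `x` are. -/
def TwoForm.SmoothAt (τ : TwoForm E M) (x : M) : Prop :=
  ContDiffAt ℝ ∞ (τ.inChart x) (extChartAt 𝓘(ℝ, E) x x)

/-- The exterior derivative of the two-form, computed in the chart around `x`, vanishes at `x`. -/
def TwoForm.ClosedAt (τ : TwoForm E M) (x : M) : Prop :=
  extDeriv (τ.inChart x) (extChartAt 𝓘(ℝ, E) x x) = 0

/-- Smoothness at `x` as a section of the bundle `L(TM, TM)`. -/
def EndField.SmoothAt [IsManifold 𝓘(ℝ, E) ∞ M] (A : EndField E M) (x : M) : Prop :=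
  ContMDiffAt 𝓘(ℝ, E) (𝓘(ℝ, E).prod 𝓘(ℝ, E →L[ℝ] E)) ∞
    (fun y ↦ TotalSpace.mk' (E →L[ℝ] E)
      (E := fun y : M ↦ TangentSpace 𝓘(ℝ, E) y →L[ℝ] TangentSpace 𝓘(ℝ, E) y) y (A y)) x

/-- Smoothness at `x` of a vector field. -/
def VectorFieldSmoothAt [IsManifold 𝓘(ℝ, E) ∞ M] (X : (x : M) → TangentSpace 𝓘(ℝ, E) x)
    (x : M) : Prop :=
  ContMDiffAt 𝓘(ℝ, E) 𝓘(ℝ, E).tangent ∞ (fun y ↦ (⟨y, X y⟩ : TangentBundle 𝓘(ℝ, E) M)) x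

/-- `ℓ` is an almost conformally symplectic structure: a smooth line subbundle of the bundle of
two-forms whose nonzero elements are non-degenerate. -/
structure IsAlmostConformallySymplectic
    (ℓ : (x : M) → Submodule ℝ (TangentSpace 𝓘(ℝ, E) x [⋀^Fin 2]→L[ℝ] ℝ)) : Prop where
  smooth_line : ∀ x, ∃ U : Set M, IsOpen U ∧ x ∈ U ∧ ∃ τ : TwoForm E M,
    ∀ y ∈ U, τ.SmoothAt y ∧ τ y ≠ 0 ∧ ℓ y = Submodule.span ℝ {τ y}
  nondegenerate : ∀ x, ∀ τ ∈ ℓ x, τ ≠ 0 →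
    ∀ v : TangentSpace 𝓘(ℝ, E) x, (∀ w : TangentSpace 𝓘(ℝ, E) x, τ ![v, w] = 0) → v = 0

/-- `ℓ` is a conformally symplectic structure: it is almost conformally symplectic, and around
each point there is a closed smooth local section which is nonzero at that point. -/
structure IsConformallySymplectic
    (ℓ : (x : M) → Submodule ℝ (TangentSpace 𝓘(ℝ, E) x [⋀^Fin 2]→L[ℝ] ℝ)) : Prop
    extends IsAlmostConformallySymplectic ℓ where
  closed_section : ∀ x, ∃ U : Set M, IsOpen U ∧ x ∈ U ∧ ∃ τ : TwoForm E M,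
    τ x ≠ 0 ∧ ∀ y ∈ U, τ y ∈ ℓ y ∧ τ.SmoothAt y ∧ τ.ClosedAt y

/-- `Q` is an almost quaternionic structure: a subbundle of `L(TM, TM)` which is locally spanned
by three smooth almost complex structures `I`, `J`, `K = I J = - J I`. -/
def IsAlmostQuaternionic [IsManifold 𝓘(ℝ, E) ∞ M]
    (Q : (x : M) → Submodule ℝ (TangentSpace 𝓘(ℝ, E) x →L[ℝ] TangentSpace 𝓘(ℝ, E) x)) : Prop :=
  ∀ x, ∃ U : Set M, IsOpen U ∧ x ∈ U ∧ ∃ I J K : EndField E M, ∀ y ∈ U,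
    (I.SmoothAt y ∧ J.SmoothAt y ∧ K.SmoothAt y) ∧
    (I y * I y = -1 ∧ J y * J y = -1 ∧ K y * K y = -1) ∧
    (I y * J y = K y ∧ J y * I y = -K y) ∧
    Q y = Submodule.span ℝ {I y, J y, K y}

/-- `τ` is the real part of a quaternionically skew-Hermitian form on the tangent space `V` at
`x`, with respect to the space `Q` of imaginary quaternionic scalars. Here `ρ` makes `V` a right
quaternionic vector space, `v q = ρ (op q) v`, for which the scalar multiplications by imaginary
quaternions form `Q`, and `b` is the skew-Hermitian form. -/
def IsRealPartOfSkewHermitian {x : M}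
    (Q : Submodule ℝ (TangentSpace 𝓘(ℝ, E) x →L[ℝ] TangentSpace 𝓘(ℝ, E) x))
    (τ : TangentSpace 𝓘(ℝ, E) x [⋀^Fin 2]→L[ℝ] ℝ) : Prop :=
  ∃ ρ : ℍ[ℝ]ᵐᵒᵖ →ₐ[ℝ] (TangentSpace 𝓘(ℝ, E) x →L[ℝ] TangentSpace 𝓘(ℝ, E) x),
    (∀ A, A ∈ Q ↔ ∃ q : ℍ[ℝ], q.re = 0 ∧ ρ (MulOpposite.op q) = A) ∧
    ∃ b : TangentSpace 𝓘(ℝ, E) x →ₗ[ℝ] TangentSpace 𝓘(ℝ, E) x →ₗ[ℝ] ℍ[ℝ],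
      (∀ q v w, b (ρ (MulOpposite.op q) v) w = star q * b v w) ∧
      (∀ q v w, b v (ρ (MulOpposite.op q) w) = b v w * q) ∧
      (∀ v w, b w v = -star (b v w)) ∧
      ∀ v w, τ ![v, w] = (b v w).re

/-- The pair `(Q, ℓ)` is a parabolic conformally symplectic structure of quaternionic type on a
manifold of dimension `4 m ≥ 8`. -/
structure IsPCSOfQuaternionicType [IsManifold 𝓘(ℝ, E) ∞ M]
    (Q : (x : M) → Submodule ℝ (TangentSpace 𝓘(ℝ, E) x →L[ℝ] TangentSpace 𝓘(ℝ, E) x))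
    (ℓ : (x : M) → Submodule ℝ (TangentSpace 𝓘(ℝ, E) x [⋀^Fin 2]→L[ℝ] ℝ)) : Prop where
  dimension : ∃ m : ℕ, 2 ≤ m ∧ Module.finrank ℝ E = 4 * m
  almostQuaternionic : IsAlmostQuaternionic Q
  conformallySymplectic : IsConformallySymplectic ℓ
  skewHermitian : ∀ x, ∀ τ ∈ ℓ x, τ ≠ 0 → IsRealPartOfSkewHermitian (Q x) τ

variable (E M) in
/-- A Riemannian metric with a smooth almost complex structure for which it is Hermitian. -/
structure AlmostHermitian [IsManifold 𝓘(ℝ, E) ∞ M] where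
  g : ContMDiffRiemannianMetric 𝓘(ℝ, E) ∞ E (fun x : M ↦ TangentSpace 𝓘(ℝ, E) x)
  J : EndField E M
  smooth : ∀ x, J.SmoothAt x
  sq : ∀ x, J x * J x = -1
  hermitian : ∀ x v w, g.inner x (J x v) (J x w) = g.inner x v w

namespace AlmostHermitian

variable [IsManifold 𝓘(ℝ, E) ∞ M]

theorem inner_J_self (h : AlmostHermitian E M) (x : M) (v : TangentSpace 𝓘(ℝ, E) x) :
    h.g.inner x v (h.J x v) = 0 := by
  have h1 := h.hermitian x v (h.J x v)
  have h2 : h.J x (h.J x v) = -v := by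
    have := congrArg (fun A ↦ A v) (h.sq x)
    simpa using this
  rw [h2, map_neg, h.g.symm] at h1
  linarith

/-- The fundamental two-form `ω(v, w) = - g(v, J w)`. -/
noncomputable def fundamentalForm (h : AlmostHermitian E M) : TwoForm E M := fun x ↦
  { toFun := fun m ↦ -h.g.inner x (m 0) (h.J x (m 1))
    map_update_add' := by
      intro inst m i v w
      obtain rfl := Subsingleton.elim inst (instDecidableEqFin 2)
      fin_cases i <;> simp [add_comm]
    map_update_smul' := by
      intro inst m i c v
      obtain rfl := Subsingleton.elim inst (instDecidableEqFin 2)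
      fin_cases i <;> simp
    cont := by fun_prop
    map_eq_zero_of_eq' := by
      intro m i j hm hij
      have h01 : m 0 = m 1 := by
        fin_cases i <;> fin_cases j <;> simp_all
      simp only [h01, h.inner_J_self, neg_zero] }

theorem fundamentalForm_apply (h : AlmostHermitian E M) (x : M)
    (v w : TangentSpace 𝓘(ℝ, E) x) :
    h.fundamentalForm x ![v, w] = -h.g.inner x v (h.J x w) := rfl

/-- The Hermitian metric is Kähler: the fundamental form is closed and the almost complex
structure is integrable (its Nijenhuis tensor vanishes). -/
structure IsKahler (h : AlmostHermitian E M) : Prop where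
  closed : ∀ x, h.fundamentalForm.ClosedAt x
  nijenhuis : ∀ (X Y : (x : M) → TangentSpace 𝓘(ℝ, E) x) (x : M),
    VectorFieldSmoothAt X x → VectorFieldSmoothAt Y x →
      VectorField.mlieBracket 𝓘(ℝ, E) (fun y ↦ h.J y (X y)) (fun y ↦ h.J y (Y y)) x =
        VectorField.mlieBracket 𝓘(ℝ, E) X Y x +
        h.J x (VectorField.mlieBracket 𝓘(ℝ, E) (fun y ↦ h.J y (X y)) Y x) +
        h.J x (VectorField.mlieBracket 𝓘(ℝ, E) X (fun y ↦ h.J y (Y y)) x)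

/-- Both the metric and the almost complex structure are preserved by the action of `G`. -/
structure IsInvariant (G : Type*) [Group G] [MulAction G M] (h : AlmostHermitian E M) :
    Prop where
  metric : ∀ (a : G) (x : M) (v w : TangentSpace 𝓘(ℝ, E) x),
    h.g.inner (a • x) (mfderiv 𝓘(ℝ, E) 𝓘(ℝ, E) (fun y : M ↦ a • y) x v)
      (mfderiv 𝓘(ℝ, E) 𝓘(ℝ, E) (fun y : M ↦ a • y) x w) = h.g.inner x v w
  complex : ∀ (a : G) (x : M) (v : TangentSpace 𝓘(ℝ, E) x),
    h.J (a • x) (mfderiv 𝓘(ℝ, E) 𝓘(ℝ, E) (fun y : M ↦ a • y) x v) =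
      mfderiv 𝓘(ℝ, E) 𝓘(ℝ, E) (fun y : M ↦ a • y) x (h.J x v)

end AlmostHermitian

/-- The family `Q` of spaces of endomorphisms is preserved by the action of `G`: the differential
of each `a` conjugates `Q x` onto `Q (a x)`. -/
def IsInvariantEndFamily (G : Type*) [Group G] [MulAction G M]
    (Q : (x : M) → Submodule ℝ (TangentSpace 𝓘(ℝ, E) x →L[ℝ] TangentSpace 𝓘(ℝ, E) x)) : Prop :=
  ∀ (a : G) (x : M), ∀ A ∈ Q x, ∃ B ∈ Q (a • x), ∀ v : TangentSpace 𝓘(ℝ, E) x,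
    B (mfderiv 𝓘(ℝ, E) 𝓘(ℝ, E) (fun y : M ↦ a • y) x v) =
      mfderiv 𝓘(ℝ, E) 𝓘(ℝ, E) (fun y : M ↦ a • y) x (A v)

end General

section Grassmannian
open Matrix
open scoped ComplexOrder

/-- The group `SU(n+2)`, written in blocks of sizes `n` and `2`. -/
abbrev SU (n : ℕ) : Type := Matrix.specialUnitaryGroup (Fin n ⊕ Fin 2) ℂ

/-- The subgroup `S(U(n) × U(2))` of block diagonal matrices in `SU(n+2)`. -/
def blockDiag (n : ℕ) : Subgroup (SU n) where
  carrier := {h | h.1.toBlocks₁₂ = 0 ∧ h.1.toBlocks₂₁ = 0}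
  one_mem' := by
    constructor
    · ext i j; simp [toBlocks₁₂]
    · ext i j; simp [toBlocks₂₁]
  mul_mem' := by
    rintro a b ⟨ha, ha'⟩ ⟨hb, hb'⟩
    have h : (a * b).1 = fromBlocks a.1.toBlocks₁₁ a.1.toBlocks₁₂ a.1.toBlocks₂₁ a.1.toBlocks₂₂ *
      fromBlocks b.1.toBlocks₁₁ b.1.toBlocks₁₂ b.1.toBlocks₂₁ b.1.toBlocks₂₂ := by
      rw [fromBlocks_toBlocks, fromBlocks_toBlocks]; rfl
    simp [h, fromBlocks_multiply, ha, ha', hb, hb']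
  inv_mem' := by
    rintro a ⟨ha, ha'⟩
    have h : (a⁻¹).1 = (fromBlocks a.1.toBlocks₁₁ a.1.toBlocks₁₂
        a.1.toBlocks₂₁ a.1.toBlocks₂₂)ᴴ := by
      rw [fromBlocks_toBlocks]; rfl
    simp [h, fromBlocks_conjTranspose, ha, ha']

/-- The homogeneous space `SU(n+2) / S(U(n) × U(2))`, with the quotient topology. -/
abbrev SymSpace (n : ℕ) : Type := SU n ⧸ blockDiag n

/-- The space of complex `n × 2` matrices, as a real normed space. -/
abbrev Mod (n : ℕ) : Type := Fin n → Fin 2 → ℂ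

/-- Square matrices of size `n + 2` in blocks of sizes `n` and `2`. -/
abbrev BMat (n : ℕ) : Type := Matrix (Fin n ⊕ Fin 2) (Fin n ⊕ Fin 2) ℂ

/-- The orthogonal projection onto the plane spanned by the last two basis vectors. -/
def baseProj (n : ℕ) : BMat n := fromBlocks 0 0 0 1

theorem SU.mul_conj {n : ℕ} (k : SU n) : k.1 * k.1ᴴ = 1 := k.2.1.2
theorem SU.conj_mul {n : ℕ} (k : SU n) : k.1ᴴ * k.1 = 1 := k.2.1.1

theorem proj_eq_iff {n : ℕ} (k l : SU n) :
    k.1 * baseProj n * k.1ᴴ = l.1 * baseProj n * l.1ᴴ ↔ k⁻¹ * l ∈ blockDiag n := by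
  have hU : (k⁻¹ * l).1 = k.1ᴴ * l.1 := rfl
  have key : k.1 * baseProj n * k.1ᴴ = l.1 * baseProj n * l.1ᴴ ↔
      baseProj n * (k⁻¹ * l).1 = (k⁻¹ * l).1 * baseProj n := by
    rw [hU]
    constructor
    · intro h
      calc baseProj n * (k.1ᴴ * l.1)
          = (k.1ᴴ * k.1) * baseProj n * (k.1ᴴ * l.1) := by rw [k.conj_mul, one_mul]
        _ = k.1ᴴ * (k.1 * baseProj n * k.1ᴴ) * l.1 := by simp only [Matrix.mul_assoc]
        _ = k.1ᴴ * (l.1 * baseProj n * l.1ᴴ) * l.1 := by rw [h]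
        _ = k.1ᴴ * l.1 * baseProj n * (l.1ᴴ * l.1) := by simp only [Matrix.mul_assoc]
        _ = _ := by rw [l.conj_mul, mul_one]
    · intro h
      calc k.1 * baseProj n * k.1ᴴ
          = k.1 * baseProj n * k.1ᴴ * (l.1 * l.1ᴴ) := by rw [l.mul_conj, mul_one]
        _ = k.1 * (baseProj n * (k.1ᴴ * l.1)) * l.1ᴴ := by simp only [Matrix.mul_assoc]
        _ = k.1 * (k.1ᴴ * l.1 * baseProj n) * l.1ᴴ := by rw [h]
        _ = (k.1 * k.1ᴴ) * l.1 * baseProj n * l.1ᴴ := by simp only [Matrix.mul_assoc]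
        _ = _ := by rw [k.mul_conj, one_mul]
  rw [key]
  generalize k⁻¹ * l = u
  have hu : u.1 = fromBlocks u.1.toBlocks₁₁ u.1.toBlocks₁₂ u.1.toBlocks₂₁ u.1.toBlocks₂₂ :=
    (fromBlocks_toBlocks _).symm
  change _ ↔ u.1.toBlocks₁₂ = 0 ∧ u.1.toBlocks₂₁ = 0
  conv_lhs => rw [hu, baseProj, fromBlocks_multiply, fromBlocks_multiply, fromBlocks_inj]
  simp [eq_comm]

/-- The orthogonal projection of `ℂⁿ⁺²` onto the plane `k (0 ⊕ ℂ²)` which corresponds to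
the coset of `k`; this is the identification of the homogeneous space with the Grassmannian
of complex planes. -/
def toProj {n : ℕ} (x : SymSpace n) : BMat n :=
  Quotient.lift (fun k : SU n ↦ k.1 * baseProj n * k.1ᴴ) (fun k l h ↦
    (proj_eq_iff k l).2 (QuotientGroup.leftRel_apply.1 h)) x

theorem toProj_mk {n : ℕ} (k : SU n) :
    toProj (QuotientGroup.mk k : SymSpace n) = k.1 * baseProj n * k.1ᴴ := rfl

theorem toProj_smul {n : ℕ} (g : SU n) (x : SymSpace n) :
    toProj (g • x) = g.1 * toProj x * g.1ᴴ := by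
  induction x using QuotientGroup.induction_on with
  | H k =>
    change (g.1 * k.1) * baseProj n * (g.1 * k.1)ᴴ = g.1 * (k.1 * baseProj n * k.1ᴴ) * g.1ᴴ
    simp only [conjTranspose_mul, Matrix.mul_assoc]

theorem toProj_injective (n : ℕ) : Function.Injective (toProj (n := n)) := by
  intro x y h
  induction x using QuotientGroup.induction_on with
  | H k =>
    induction y using QuotientGroup.induction_on with
    | H l => exact QuotientGroup.eq.2 ((proj_eq_iff k l).1 h)

theorem continuous_toProj (n : ℕ) : Continuous (toProj (n := n)) := by
  refine Continuous.quotient_lift ?_ _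
  exact (continuous_subtype_val.matrix_mul continuous_const).matrix_mul
    continuous_subtype_val.matrix_conjTranspose

instance compactSpace_SU (n : ℕ) : CompactSpace (SU n) := by
  refine isCompact_iff_compactSpace (s := (Matrix.specialUnitaryGroup (Fin n ⊕ Fin 2) ℂ :
    Set (BMat n))).1 ?_
  have hcl : IsClosed ((Matrix.specialUnitaryGroup (Fin n ⊕ Fin 2) ℂ : Set (BMat n))) := by
    have h : (Matrix.specialUnitaryGroup (Fin n ⊕ Fin 2) ℂ : Set (BMat n)) =
        {A | star A * A = 1} ∩ {A | A.det = 1} := by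
      ext A
      simp only [SetLike.mem_coe, Matrix.mem_specialUnitaryGroup_iff,
        Matrix.mem_unitaryGroup_iff', Set.mem_inter_iff, Set.mem_ofPred_eq]
    rw [h]
    refine (isClosed_eq ?_ continuous_const).inter (isClosed_eq ?_ continuous_const)
    · exact Continuous.matrix_mul continuous_star continuous_id
    · exact Continuous.matrix_det continuous_id
  have hK : IsCompact (Set.univ.pi fun _ : Fin n ⊕ Fin 2 ↦ Set.univ.pi
      fun _ : Fin n ⊕ Fin 2 ↦ Metric.closedBall (0 : ℂ) 1) :=
    isCompact_univ_pi fun _ ↦ isCompact_univ_pi fun _ ↦ isCompact_closedBall _ _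
  refine IsCompact.of_isClosed_subset hK hcl ?_
  intro A hA i _ j _
  simpa using entry_norm_bound_of_unitary hA.1 i j

theorem isClosedEmbedding_toProj (n : ℕ) : Topology.IsClosedEmbedding (toProj (n := n)) :=
  (continuous_toProj n).isClosedEmbedding (toProj_injective n)

/-- `(1 + X* X)⁻¹`. -/
noncomputable def gramInv {n : ℕ} (X : Matrix (Fin n) (Fin 2) ℂ) : Matrix (Fin 2) (Fin 2) ℂ :=
  (1 + Xᴴ * X)⁻¹

theorem posDef_gram {m k : Type*} [Fintype m] [Fintype k] [DecidableEq k]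
    (X : Matrix m k ℂ) : (1 + Xᴴ * X).PosDef :=
  Matrix.PosDef.one.add_posSemidef (posSemidef_conjTranspose_mul_self X)

theorem det_gram_ne {m k : Type*} [Fintype m] [Fintype k] [DecidableEq k]
    (X : Matrix m k ℂ) : (1 + Xᴴ * X).det ≠ 0 := (posDef_gram X).det_pos.ne'

/-- The orthogonal projection onto the graph `{(X v, v)}` of the matrix `X`. -/
noncomputable def graphProj {n : ℕ} (X : Matrix (Fin n) (Fin 2) ℂ) : BMat n :=
  fromBlocks (X * gramInv X * Xᴴ) (X * gramInv X) (gramInv X * Xᴴ) (gramInv X)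

theorem unit_gramInv {n : ℕ} (X : Matrix (Fin n) (Fin 2) ℂ) : IsUnit (gramInv X).det := by
  rw [gramInv, det_nonsing_inv, Ring.inverse_eq_inv']
  exact (inv_ne_zero (det_gram_ne X)).isUnit

theorem conj_baseProj {n : ℕ} (A : Matrix (Fin n) (Fin n) ℂ) (B : Matrix (Fin n) (Fin 2) ℂ)
    (C : Matrix (Fin 2) (Fin n) ℂ) (D : Matrix (Fin 2) (Fin 2) ℂ) :
    fromBlocks A B C D * baseProj n * (fromBlocks A B C D)ᴴ =
      fromBlocks (B * Bᴴ) (B * Dᴴ) (D * Bᴴ) (D * Dᴴ) := by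
  simp [baseProj, fromBlocks_multiply, fromBlocks_conjTranspose]

theorem conj_baseProj_eq_graphProj {n : ℕ} {A : Matrix (Fin n) (Fin n) ℂ}
    {B : Matrix (Fin n) (Fin 2) ℂ} {C : Matrix (Fin 2) (Fin n) ℂ} {D : Matrix (Fin 2) (Fin 2) ℂ}
    (h : (fromBlocks A B C D)ᴴ * fromBlocks A B C D = 1) (hD : IsUnit D.det) :
    fromBlocks A B C D * baseProj n * (fromBlocks A B C D)ᴴ = graphProj (B * D⁻¹) := by
  have h1 : Bᴴ * B + Dᴴ * D = 1 := by
    rw [fromBlocks_conjTranspose, fromBlocks_multiply, ← fromBlocks_one, fromBlocks_inj] at h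
    exact h.2.2.2
  have hX : B * D⁻¹ * D = B := nonsing_inv_mul_cancel_right _ _ hD
  have h2 : Dᴴ * ((1 + (B * D⁻¹)ᴴ * (B * D⁻¹)) * D) = 1 := by
    calc Dᴴ * ((1 + (B * D⁻¹)ᴴ * (B * D⁻¹)) * D)
        = Dᴴ * D + (B * D⁻¹ * D)ᴴ * (B * D⁻¹ * D) := by
          simp only [conjTranspose_mul, Matrix.mul_add, Matrix.add_mul, Matrix.one_mul,
            Matrix.mul_assoc]
      _ = 1 := by rw [hX, add_comm, h1]
  have hN : gramInv (B * D⁻¹) = D * Dᴴ := by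
    refine inv_eq_right_inv ?_
    rw [← Matrix.mul_assoc]
    exact mul_eq_one_comm.1 h2
  rw [conj_baseProj, graphProj, hN]
  have e1 : B * D⁻¹ * (D * Dᴴ) = B * Dᴴ := by rw [← Matrix.mul_assoc, hX]
  have e2 : D * Dᴴ * (B * D⁻¹)ᴴ = D * Bᴴ := by
    rw [Matrix.mul_assoc, ← conjTranspose_mul, hX]
  rw [e1, e2, Matrix.mul_assoc B, ← conjTranspose_mul, hX]

theorem exists_factor {k : Type*} [Fintype k] [DecidableEq k] {A : Matrix k k ℂ} (hA : A.PosDef) :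
    ∃ L : Matrix k k ℂ, IsUnit L.det ∧ Lᴴ * A * L = 1 := by
  obtain ⟨B, hB⟩ : ∃ B : Matrix k k ℂ, A = Bᴴ * B := by
    open scoped MatrixOrder in
    obtain ⟨B, hB⟩ := CStarAlgebra.nonneg_iff_eq_star_mul_self.1 hA.posSemidef.nonneg
    exact ⟨B, hB⟩
  have hdet : IsUnit B.det := by
    have := hA.det_pos.ne'
    rw [hB, det_mul] at this
    exact (right_ne_zero_of_mul this).isUnit
  refine ⟨B⁻¹, by rw [det_nonsing_inv]; simpa using hdet, ?_⟩
  calc (B⁻¹)ᴴ * A * B⁻¹ = (B * B⁻¹)ᴴ * (B * B⁻¹) := by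
        rw [hB]; simp only [conjTranspose_mul, Matrix.mul_assoc]
    _ = 1 := by rw [mul_nonsing_inv _ hdet]; simp

theorem exists_toProj_eq {n : ℕ} (X : Matrix (Fin n) (Fin 2) ℂ) :
    ∃ x : SymSpace n, toProj x = graphProj X := by
  obtain ⟨L, hL, hLX⟩ := exists_factor (posDef_gram X)
  obtain ⟨K, hK, hKX⟩ := exists_factor (posDef_gram Xᴴ)
  rw [conjTranspose_conjTranspose] at hKX
  set c : ℂ := (fromBlocks K (X * L) (-(Xᴴ * K)) L).det with hc
  have hU0 : (fromBlocks K (X * L) (-(Xᴴ * K)) L)ᴴ *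
      fromBlocks K (X * L) (-(Xᴴ * K)) L = 1 := by
    rw [fromBlocks_conjTranspose, fromBlocks_multiply, ← fromBlocks_one, fromBlocks_inj]
    refine ⟨?_, ?_, ?_, ?_⟩
    · rw [← hKX]
      simp only [conjTranspose_neg, conjTranspose_mul, conjTranspose_conjTranspose,
        Matrix.mul_add, Matrix.add_mul, Matrix.mul_one, Matrix.mul_assoc, Matrix.neg_mul,
        Matrix.mul_neg, neg_neg]
    · simp [Matrix.mul_assoc]
    · simp [Matrix.mul_assoc]
    · rw [← hLX]
      simp only [conjTranspose_mul, Matrix.mul_add, Matrix.add_mul, Matrix.mul_one,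
        Matrix.mul_assoc, add_comm]
  have hcc : star c * c = 1 := by
    have := congrArg Matrix.det hU0
    rwa [det_mul, det_conjTranspose, det_one] at this
  let T : Matrix (Fin 2) (Fin 2) ℂ := diagonal ![star c, 1]
  have hT : Tᴴ * T = 1 := by
    ext i j
    fin_cases i <;> fin_cases j <;> simp [T]
    simpa [mul_comm] using hcc
  have hTdet : T.det = star c := by simp [T, det_diagonal]
  have hW : fromBlocks K (X * L * T) (-(Xᴴ * K)) (L * T) =
      fromBlocks K (X * L) (-(Xᴴ * K)) L * fromBlocks 1 0 0 T := by
    simp [fromBlocks_multiply]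
  have hW1 : (fromBlocks K (X * L * T) (-(Xᴴ * K)) (L * T))ᴴ *
      fromBlocks K (X * L * T) (-(Xᴴ * K)) (L * T) = 1 := by
    rw [hW, conjTranspose_mul, Matrix.mul_assoc, ← Matrix.mul_assoc _ _ (fromBlocks 1 0 0 T), hU0,
      Matrix.one_mul, fromBlocks_conjTranspose, fromBlocks_multiply]
    simp [hT]
  have hWdet : (fromBlocks K (X * L * T) (-(Xᴴ * K)) (L * T)).det = 1 := by
    rw [hW, det_mul, ← hc, det_fromBlocks_zero₂₁, det_one, one_mul, hTdet, mul_comm, hcc]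
  have hTu : IsUnit T.det := by
    rw [hTdet]
    exact IsUnit.of_mul_eq_one _ hcc
  have hLT : IsUnit (L * T).det := by
    rw [det_mul]; exact hL.mul hTu
  let k : SU n := ⟨fromBlocks K (X * L * T) (-(Xᴴ * K)) (L * T),
    Matrix.mem_unitaryGroup_iff'.2 hW1, hWdet⟩
  refine ⟨QuotientGroup.mk k, ?_⟩
  rw [toProj_mk, conj_baseProj_eq_graphProj hW1 hLT]
  congr 1
  rw [Matrix.mul_assoc X, mul_nonsing_inv_cancel_right _ _ hLT]

/-- The matrix `(g* P g)`, where `P` is the projection corresponding to `x`. -/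
def shiftProj {n : ℕ} (g : SU n) (x : SymSpace n) : BMat n := g.1ᴴ * toProj x * g.1

theorem shiftProj_eq {n : ℕ} (g : SU n) (x : SymSpace n) :
    shiftProj g x = toProj (g⁻¹ • x) := by
  rw [toProj_smul, shiftProj]
  change _ = g.1ᴴ * toProj x * g.1ᴴᴴ
  rw [conjTranspose_conjTranspose]

/-- The graph coordinates centred at the coset of `g`: if `g⁻¹ k` has last two columns
`(C, A)`, then the coset of `k` is mapped to `C A⁻¹`; equivalently, the plane of `g⁻¹ k` is the
graph of `C A⁻¹`. -/
noncomputable def graphCoord {n : ℕ} (g : SU n) (x : SymSpace n) : Matrix (Fin n) (Fin 2) ℂ :=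
  (shiftProj g x).toBlocks₁₂ * (shiftProj g x).toBlocks₂₂⁻¹

theorem graphCoord_of_shiftProj {n : ℕ} {g : SU n} {x : SymSpace n}
    {X : Matrix (Fin n) (Fin 2) ℂ} (h : shiftProj g x = graphProj X) : graphCoord g x = X := by
  rw [graphCoord, h, graphProj, toBlocks_fromBlocks₁₂, toBlocks_fromBlocks₂₂,
    mul_nonsing_inv_cancel_right _ _ (unit_gramInv X)]

theorem graphCoord_mk {n : ℕ} (g k : SU n) (h : ((g⁻¹ * k).1.toBlocks₂₂).det ≠ 0) :
    shiftProj g (QuotientGroup.mk k : SymSpace n) =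
        graphProj ((g⁻¹ * k).1.toBlocks₁₂ * (g⁻¹ * k).1.toBlocks₂₂⁻¹) ∧
      graphCoord g (QuotientGroup.mk k : SymSpace n) =
        (g⁻¹ * k).1.toBlocks₁₂ * (g⁻¹ * k).1.toBlocks₂₂⁻¹ := by
  have h1 : shiftProj g (QuotientGroup.mk k : SymSpace n) =
        graphProj ((g⁻¹ * k).1.toBlocks₁₂ * (g⁻¹ * k).1.toBlocks₂₂⁻¹) := by
    rw [shiftProj_eq]
    change toProj (QuotientGroup.mk (g⁻¹ * k) : SymSpace n) = _
    rw [toProj_mk]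
    have hU := (g⁻¹ * k).conj_mul
    generalize (g⁻¹ * k).1 = U at *
    rw [← fromBlocks_toBlocks U] at hU
    conv_lhs => rw [← fromBlocks_toBlocks U]
    exact conj_baseProj_eq_graphProj hU h.isUnit
  exact ⟨h1, graphCoord_of_shiftProj h1⟩

theorem det_shiftProj_mk {n : ℕ} (g k : SU n) :
    (shiftProj g (QuotientGroup.mk k : SymSpace n)).toBlocks₂₂.det =
      ((g⁻¹ * k).1.toBlocks₂₂).det * star ((g⁻¹ * k).1.toBlocks₂₂).det := by
  rw [shiftProj_eq]
  change (toProj (QuotientGroup.mk (g⁻¹ * k) : SymSpace n)).toBlocks₂₂.det = _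
  rw [toProj_mk]
  generalize (g⁻¹ * k).1 = U
  conv_lhs => rw [← fromBlocks_toBlocks U]
  rw [conj_baseProj, toBlocks_fromBlocks₂₂, det_mul, det_conjTranspose]

theorem exists_shiftProj_eq {n : ℕ} (g : SU n) (X : Matrix (Fin n) (Fin 2) ℂ) :
    ∃ x : SymSpace n, shiftProj g x = graphProj X := by
  obtain ⟨x, hx⟩ := exists_toProj_eq X
  exact ⟨g • x, by rw [shiftProj_eq, inv_smul_smul, hx]⟩

theorem shiftProj_injective {n : ℕ} (g : SU n) : Function.Injective (shiftProj g) := by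
  intro x y h
  rw [shiftProj_eq, shiftProj_eq] at h
  exact MulAction.injective g⁻¹ (toProj_injective n h)

theorem toProj_eq_shift {n : ℕ} (g : SU n) (x : SymSpace n) :
    toProj x = g.1 * shiftProj g x * g.1ᴴ := by
  rw [shiftProj_eq, ← toProj_smul, smul_inv_smul]

theorem shiftProj_graphCoord {n : ℕ} {g : SU n} {x : SymSpace n}
    (h : (shiftProj g x).toBlocks₂₂.det ≠ 0) : shiftProj g x = graphProj (graphCoord g x) := by
  induction x using QuotientGroup.induction_on with
  | H k =>
    rw [det_shiftProj_mk] at h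
    obtain ⟨h1, h2⟩ := graphCoord_mk g k (left_ne_zero_of_mul h)
    rw [h1, h2]

theorem continuousOn_inv {k : ℕ} :
    ContinuousOn (fun A : Matrix (Fin k) (Fin k) ℂ ↦ A⁻¹) {A | A.det ≠ 0} := by
  simp only [inv_def, Ring.inverse_eq_inv']
  exact (ContinuousOn.inv₀ (Continuous.matrix_det continuous_id).continuousOn fun _ h ↦ h).smul
    (Continuous.matrix_adjugate continuous_id).continuousOn

theorem continuous_gramInv {n : ℕ} :
    Continuous (gramInv : Matrix (Fin n) (Fin 2) ℂ → Matrix (Fin 2) (Fin 2) ℂ) := by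
  refine continuousOn_inv.comp_continuous (f := fun X : Matrix (Fin n) (Fin 2) ℂ ↦ 1 + Xᴴ * X)
    ?_ fun X ↦ det_gram_ne X
  exact continuous_const.add (continuous_id.matrix_conjTranspose.matrix_mul continuous_id)

theorem continuous_graphProj {n : ℕ} :
    Continuous (graphProj : Matrix (Fin n) (Fin 2) ℂ → BMat n) := by
  have h := continuous_gramInv (n := n)
  have hs : Continuous fun X : Matrix (Fin n) (Fin 2) ℂ ↦ Xᴴ :=
    continuous_id.matrix_conjTranspose
  exact Continuous.matrix_fromBlocks ((continuous_id.matrix_mul h).matrix_mul hs)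
    (continuous_id.matrix_mul h) (h.matrix_mul hs) h

theorem continuous_shiftProj {n : ℕ} (g : SU n) : Continuous (shiftProj g) :=
  (continuous_const.matrix_mul (continuous_toProj n)).matrix_mul continuous_const

theorem continuousOn_graphCoord {n : ℕ} (g : SU n) :
    ContinuousOn (graphCoord g) {x | (shiftProj g x).toBlocks₂₂.det ≠ 0} := by
  have h1 : Continuous fun x ↦ (shiftProj g x).toBlocks₁₂ :=
    (continuous_shiftProj g).matrix_submatrix _ _
  have h2 : Continuous fun x ↦ (shiftProj g x).toBlocks₂₂ :=
    (continuous_shiftProj g).matrix_submatrix _ _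
  have hd : Continuous fun x ↦ (shiftProj g x).toBlocks₂₂.det := h2.matrix_det
  have h3 : ContinuousOn (fun x ↦ (shiftProj g x).toBlocks₂₂⁻¹)
      {x | (shiftProj g x).toBlocks₂₂.det ≠ 0} := by
    simp only [inv_def, Ring.inverse_eq_inv']
    refine ContinuousOn.smul (ContinuousOn.inv₀ hd.continuousOn ?_) h2.matrix_adjugate.continuousOn
    intro x hx
    exact hx
  have h4 : Continuous fun p : Matrix (Fin n) (Fin 2) ℂ × Matrix (Fin 2) (Fin 2) ℂ ↦
    p.1 * p.2 := continuous_fst.matrix_mul continuous_snd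
  have h5 := h4.comp_continuousOn (h1.continuousOn.prodMk h3)
  exact h5

/-- The graph chart of the homogeneous space centred at the coset of `g`. -/
noncomputable def graphChart {n : ℕ} (g : SU n) : OpenPartialHomeomorph (SymSpace n) (Mod n) where
  toFun x := Matrix.of.symm (graphCoord g x)
  invFun X := (exists_shiftProj_eq g (Matrix.of X)).choose
  source := {x | (shiftProj g x).toBlocks₂₂.det ≠ 0}
  target := Set.univ
  map_source' _ _ := Set.mem_univ _
  map_target' X _ := by
    rw [Set.mem_ofPred_eq, (exists_shiftProj_eq g (Matrix.of X)).choose_spec, graphProj,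
      toBlocks_fromBlocks₂₂]
    exact (unit_gramInv _).ne_zero
  left_inv' x hx := by
    apply shiftProj_injective g
    rw [(exists_shiftProj_eq g (Matrix.of (Matrix.of.symm (graphCoord g x)))).choose_spec,
      Equiv.apply_symm_apply, ← shiftProj_graphCoord hx]
  right_inv' X _ := by
    rw [graphCoord_of_shiftProj (exists_shiftProj_eq g (Matrix.of X)).choose_spec,
      Equiv.symm_apply_apply]
  open_source := by
    have h : Continuous fun x ↦ (shiftProj g x).toBlocks₂₂.det := by
      refine Continuous.matrix_det ?_
      exact (continuous_shiftProj g).matrix_submatrix _ _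
    exact isOpen_ne_fun h continuous_const
  open_target := isOpen_univ
  continuousOn_toFun := by
    have h : Continuous (Matrix.of.symm : Matrix (Fin n) (Fin 2) ℂ ≃ Mod n) := continuous_id
    exact h.comp_continuousOn (continuousOn_graphCoord g)
  continuousOn_invFun := by
    refine Continuous.continuousOn ?_
    rw [(isClosedEmbedding_toProj n).isInducing.continuous_iff]
    have h : (toProj ∘ fun X : Mod n ↦ (exists_shiftProj_eq g (Matrix.of X)).choose) =
        fun X : Mod n ↦ g.1 * graphProj (Matrix.of X) * g.1ᴴ := by
      funext X
      rw [Function.comp_apply, toProj_eq_shift g, (exists_shiftProj_eq g (Matrix.of X)).choose_spec]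
    rw [h]
    have ho : Continuous (Matrix.of : Mod n ≃ Matrix (Fin n) (Fin 2) ℂ) := continuous_id
    exact (continuous_const.matrix_mul (continuous_graphProj.comp ho)).matrix_mul continuous_const

theorem mem_graphChart_source {n : ℕ} (k : SU n) :
    (QuotientGroup.mk k : SymSpace n) ∈ (graphChart k).source := by
  change (shiftProj k (QuotientGroup.mk k : SymSpace n)).toBlocks₂₂.det ≠ 0
  rw [det_shiftProj_mk, inv_mul_cancel]
  have : (1 : SU n).1.toBlocks₂₂ = 1 := by
    change (1 : BMat n).toBlocks₂₂ = 1
    rw [← fromBlocks_one, toBlocks_fromBlocks₂₂]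
  rw [this]
  simp

/-- The manifold structure of the homogeneous space, modelled on the real vector space of complex
`n × 2` matrices: the atlas consists of all graph charts. -/
noncomputable instance chartedSpace_SymSpace (n : ℕ) : ChartedSpace (Mod n) (SymSpace n) where
  atlas := Set.range graphChart
  chartAt x := graphChart x.out
  mem_chart_source x := by
    have := mem_graphChart_source (n := n) x.out
    rwa [QuotientGroup.out_eq'] at this
  chart_mem_atlas x := Set.mem_range_self _

/-- Entrywise smoothness of a matrix valued map. -/
def EntrySmooth {n : ℕ} {a b : Type*} (s : Set (Mod n)) (F : Mod n → Matrix a b ℂ) : Prop :=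
  ∀ i j, ContDiffOn ℝ ∞ (fun X ↦ F X i j) s

theorem EntrySmooth.const {n : ℕ} {a b : Type*} {s : Set (Mod n)} (A : Matrix a b ℂ) :
    EntrySmooth s fun _ ↦ A := fun _ _ ↦ contDiffOn_const

theorem EntrySmooth.mul {n : ℕ} {a b c : Type*} [Fintype b] {s : Set (Mod n)}
    {F : Mod n → Matrix a b ℂ} {G : Mod n → Matrix b c ℂ} (hF : EntrySmooth s F)
    (hG : EntrySmooth s G) : EntrySmooth s fun X ↦ F X * G X := fun i j ↦ by
  simp only [Matrix.mul_apply]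
  exact ContDiffOn.sum fun k _ ↦ (hF i k).mul (hG k j)

theorem EntrySmooth.conj {n : ℕ} {a b : Type*} {s : Set (Mod n)}
    {F : Mod n → Matrix a b ℂ} (hF : EntrySmooth s F) : EntrySmooth s fun X ↦ (F X)ᴴ :=
  fun i j ↦ Complex.conjCLE.contDiff.comp_contDiffOn (hF j i)

theorem EntrySmooth.inv {n : ℕ} {s : Set (Mod n)}
    {F : Mod n → Matrix (Fin 2) (Fin 2) ℂ} (hF : EntrySmooth s F)
    (h : ∀ X ∈ s, (F X).det ≠ 0) : EntrySmooth s fun X ↦ (F X)⁻¹ := by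
  have hdet : ContDiffOn ℝ ∞ (fun X ↦ (F X).det) s := by
    simp only [det_fin_two]
    exact ((hF 0 0).mul (hF 1 1)).sub ((hF 0 1).mul (hF 1 0))
  have hi := hdet.inv h
  intro i j
  simp only [inv_def, Ring.inverse_eq_inv', adjugate_fin_two, Matrix.smul_apply, smul_eq_mul]
  refine hi.mul ?_
  fin_cases i <;> fin_cases j
  · exact hF 1 1
  · exact (hF 0 1).neg
  · exact (hF 1 0).neg
  · exact hF 0 0

theorem entrySmooth_id {n : ℕ} {s : Set (Mod n)} :
    EntrySmooth s fun X : Mod n ↦ (Matrix.of X) := fun i j ↦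
  (contDiff_apply_apply (𝕜 := ℝ) (n := ∞) (E := ℂ) i j).contDiffOn

theorem entrySmooth_graphProj {n : ℕ} {s : Set (Mod n)} :
    EntrySmooth s fun X : Mod n ↦ graphProj (Matrix.of X) := by
  have hX := entrySmooth_id (n := n) (s := s)
  have hN : EntrySmooth s fun X : Mod n ↦ gramInv (Matrix.of X) := by
    refine EntrySmooth.inv (F := fun X : Mod n ↦
      1 + (Matrix.of X)ᴴ * (Matrix.of X)) ?_
      fun X _ ↦ det_gram_ne _
    exact fun i j ↦ contDiffOn_const.add (hX.conj.mul hX i j)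
  rintro (i | i) (j | j)
  · exact (hX.mul hN).mul hX.conj i j
  · exact hX.mul hN i j
  · exact hN.mul hX.conj i j
  · exact hN i j

instance isManifold_SymSpace (n : ℕ) : IsManifold 𝓘(ℝ, Mod n) ∞ (SymSpace n) := by
  refine isManifold_of_contDiffOn _ _ _ ?_
  intro _ _ hg hg'
  obtain ⟨g, rfl⟩ := (hg : _ ∈ Set.range graphChart)
  obtain ⟨g', rfl⟩ := (hg' : _ ∈ Set.range graphChart)
  set s := 𝓘(ℝ, Mod n).symm ⁻¹' ((graphChart g).symm ≫ₕ graphChart g').source ∩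
    Set.range 𝓘(ℝ, Mod n) with hs
  have key : ∀ X : Mod n, shiftProj g' ((graphChart g).symm X) =
      (g'.1ᴴ * g.1) * graphProj (Matrix.of X) * (g'.1ᴴ * g.1)ᴴ := fun X ↦ by
    have h : shiftProj g ((graphChart g).symm X) = graphProj (Matrix.of X) :=
      (exists_shiftProj_eq g (Matrix.of X)).choose_spec
    rw [shiftProj, toProj_eq_shift g, h]
    simp only [conjTranspose_mul, conjTranspose_conjTranspose, Matrix.mul_assoc]
  have hP : EntrySmooth s fun X ↦ shiftProj g' ((graphChart g).symm X) := by
    simp only [key]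
    exact ((EntrySmooth.const _).mul entrySmooth_graphProj).mul (EntrySmooth.const _)
  have h22 : EntrySmooth s fun X ↦ (shiftProj g' ((graphChart g).symm X)).toBlocks₂₂ :=
    fun i j ↦ hP (Sum.inr i) (Sum.inr j)
  have h12 : EntrySmooth s fun X ↦ (shiftProj g' ((graphChart g).symm X)).toBlocks₁₂ :=
    fun i j ↦ hP (Sum.inl i) (Sum.inr j)
  have hfin := h12.mul (h22.inv fun X hX ↦ hX.1.2)
  exact contDiffOn_pi.2 fun i ↦ contDiffOn_pi.2 fun j ↦ hfin i j

end Grassmannian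

section Quaternionic
open Matrix

/-- The inclusion of `SU(2)` into `S(U(n) × U(2))` as the lower diagonal block. -/
def inclSU2 (n : ℕ) (S : Matrix.specialUnitaryGroup (Fin 2) ℂ) : SU n :=
  ⟨fromBlocks 1 0 0 S.1, by
    refine ⟨Matrix.mem_unitaryGroup_iff'.2 ?_, ?_⟩
    · have h : S.1ᴴ * S.1 = 1 := S.2.1.1
      rw [star_eq_conjTranspose, fromBlocks_conjTranspose, fromBlocks_multiply]
      simp [h]
    · have h : S.1.det = 1 := S.2.2
      change (fromBlocks 1 0 0 S.1).det = 1
      rw [det_fromBlocks_zero₂₁, det_one, one_mul, h]⟩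

/-- The isotropy representation: an element `s` of `SU(n+2)` which fixes `x` acts on the tangent
space at `x` through the differential at `x` of `y ↦ s y`. -/
noncomputable def isotropyMap {n : ℕ} (s : SU n) (x : SymSpace n) (_hs : s • x = x) :
    TangentSpace 𝓘(ℝ, Mod n) x →L[ℝ] TangentSpace 𝓘(ℝ, Mod n) x :=
  mfderiv 𝓘(ℝ, Mod n) 𝓘(ℝ, Mod n) (fun y : SymSpace n ↦ s • y) x

/-- The quaternionic structure of the symmetric space. At the base point, the tangent space is the
space of complex `n × 2` matrices `X`, the isotropy action of `S` in `SU(2)` is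
`X ↦ X S⁻¹`, and the imaginary unit quaternions are the multiplications from the right by those
`S` in `SU(2)` with `S² = -1`, which span the multiplications by all elements of the Lie algebra
of `SU(2)`. At the coset `x` of `k`, this is transported by `k`. -/
noncomputable def quaternionicStructure (n : ℕ) (x : SymSpace n) :
    Submodule ℝ (TangentSpace 𝓘(ℝ, Mod n) x →L[ℝ] TangentSpace 𝓘(ℝ, Mod n) x) :=
  Submodule.span ℝ {A | ∃ (k : SU n) (S : Matrix.specialUnitaryGroup (Fin 2) ℂ)
    (hs : (k * inclSU2 n S * k⁻¹) • x = x),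
    (QuotientGroup.mk k : SymSpace n) = x ∧ S.1 * S.1 = -1 ∧
      A = isotropyMap (k * inclSU2 n S * k⁻¹) x hs}

end Quaternionic

end QuatPCS

/-! The tangent space at `y` is identified with `Mod n` through the graph chart centred at the
chosen representative `y.out`. In graph coordinates the group acts by Möbius transformations X ↦ (AX
+ B)(CX + D)⁻¹, so every differential that occurs has the form v ↦ E v T. For the action between the
charts centred at a point and at its image it is v ↦ A v D* with A and D unitary (`mfderiv_action`);
for the chart at `x`, seen from `y`, E is a Schur complement and T = D⁻¹ (`mfderiv_chart`). In these
coordinates each fibre of the quaternionic family is right multiplication by su(2)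
(`quaternionicStructure_eq`), and invariance is a matter of conjugating by unitary blocks.

The representatives `y.out` need not depend continuously on `y`, so formulas that are constant in
these coordinates do not yet give smoothness: everything has to be carried into one fixed chart.
There only D D* = (1 + X*X)⁻¹ is smooth in X, not D itself. For the quaternionic family, D is
replaced by a smooth multiple of the positive square root of (1 + X*X)⁻¹, which differs from D on
the right by a scalar times a unitary matrix; conjugation by such a factor preserves su(2). This
gives the smooth frame (`gramFrame_mul_conj`, `frameField_smoothAt`, `span_frameField`).

The invariant Kähler structure is Re tr(v* w) with multiplication by i. The latter commutes with all
maps v ↦ E v T, so it is constant in every chart and its Nijenhuis tensor vanishes. The fundamental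
form is exact in every chart, with primitive ½ Im tr((1 + X*X)⁻¹ X* dX)
(`standardHermitian_inChart`); up to normalization the Kähler potential is log det(1 + X*X).

For an arbitrary invariant Kähler structure no classification is needed. The imaginary unit
quaternions are themselves isotropy transformations, hence preserve ω
(`fundamentalBilin_invariant`). For a skew form this is exactly what makes ω − Σ ω(·, ·e) e, with e
running over i, j, k, quaternionically skew-Hermitian (`quatForm_skew`). Non-degeneracy comes from
ω(v, Jv) = g(v, v), and ω itself is the closed section. -/

namespace QuatPCS

/-! ### Möbius transformations in graph coordinates -/

section Transitions
open Matrix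

/-- The real linear map `v ↦ E v T` on complex `n × 2` matrices. -/
noncomputable def mulLR {n : ℕ} (E : Matrix (Fin n) (Fin n) ℂ) (T : Matrix (Fin 2) (Fin 2) ℂ) :
    Mod n →L[ℝ] Mod n :=
  LinearMap.toContinuousLinearMap
    { toFun := fun v ↦ Matrix.of.symm (E * Matrix.of v * T)
      map_add' := fun v w ↦ by
        change (_ : Matrix (Fin n) (Fin 2) ℂ) = E * of v * T + E * of w * T
        rw [← Matrix.add_mul, ← Matrix.mul_add]; rfl
      map_smul' := fun c v ↦ by
        change (_ : Matrix (Fin n) (Fin 2) ℂ) = c • (E * of v * T)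
        rw [← Matrix.smul_mul, ← Matrix.mul_smul]; rfl }

theorem mulLR_apply {n : ℕ} (E : Matrix (Fin n) (Fin n) ℂ) (T : Matrix (Fin 2) (Fin 2) ℂ)
    (v : Mod n) : mulLR E T v = Matrix.of.symm (E * Matrix.of v * T) := rfl

theorem mulLR_mul {n : ℕ} (E E' : Matrix (Fin n) (Fin n) ℂ) (T T' : Matrix (Fin 2) (Fin 2) ℂ) :
    mulLR E T * mulLR E' T' = mulLR (E * E') (T' * T) := by
  ext1 v
  change of.symm (E * (E' * of v * T') * T) = of.symm (E * E' * of v * (T' * T))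
  simp only [Matrix.mul_assoc]

theorem mulLR_comp {n : ℕ} (E E' : Matrix (Fin n) (Fin n) ℂ) (T T' : Matrix (Fin 2) (Fin 2) ℂ) :
    (mulLR E T).comp (mulLR E' T') = mulLR (E * E') (T' * T) := mulLR_mul E E' T T'

theorem mulLR_one {n : ℕ} : mulLR (n := n) 1 1 = 1 := by
  ext1 v
  change (1 : Matrix (Fin n) (Fin n) ℂ) * of v * (1 : Matrix (Fin 2) (Fin 2) ℂ) = of v
  rw [Matrix.one_mul, Matrix.mul_one]

theorem mulLR_add {n : ℕ} (E : Matrix (Fin n) (Fin n) ℂ) (T T' : Matrix (Fin 2) (Fin 2) ℂ) :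
    mulLR E (T + T') = mulLR E T + mulLR E T' := by
  ext1 v
  change of.symm (E * of v * (T + T')) = E * of v * T + E * of v * T'
  rw [Matrix.mul_add]; rfl

theorem mulLR_smul {n : ℕ} (c : ℝ) (E : Matrix (Fin n) (Fin n) ℂ)
    (T : Matrix (Fin 2) (Fin 2) ℂ) : mulLR E (c • T) = c • mulLR E T := by
  ext1 v
  change of.symm (E * of v * (c • T)) = c • (E * of v * T)
  rw [Matrix.mul_smul]; rfl

/-- Multiplication from the right, as a linear function of the matrix. -/
noncomputable def rightMul (n : ℕ) : Matrix (Fin 2) (Fin 2) ℂ →ₗ[ℝ] (Mod n →L[ℝ] Mod n) where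
  toFun := mulLR 1
  map_add' := mulLR_add 1
  map_smul' c T := mulLR_smul c 1 T

theorem rightMul_apply (n : ℕ) (T : Matrix (Fin 2) (Fin 2) ℂ) : rightMul n T = mulLR 1 T := rfl

/-- The derivative at `0` of a matrix valued Möbius transformation. -/
theorem hasFDerivAt_moebius {n : ℕ} (A : Matrix (Fin n) (Fin n) ℂ) (B : Matrix (Fin n) (Fin 2) ℂ)
    (C : Matrix (Fin 2) (Fin n) ℂ) (D : Matrix (Fin 2) (Fin 2) ℂ) (hD : D.det ≠ 0) :
    HasFDerivAt (fun Y : Mod n ↦ (Matrix.of.symm ((A * of Y + B) * (C * of Y + D)⁻¹) : Mod n))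
      (mulLR (A - B * D⁻¹ * C) D⁻¹) 0 := by
  set s : Set (Mod n) := {Y | (C * of Y + D).det ≠ 0} with hs
  have hlin : EntrySmooth Set.univ fun Y : Mod n ↦ C * of Y + D := fun i j ↦
    (((EntrySmooth.const C).mul entrySmooth_id) i j).add contDiffOn_const
  have hopen : IsOpen s := by
    have h : Continuous fun Y : Mod n ↦ (C * of Y + D).det := by
      refine Continuous.matrix_det ?_
      refine continuous_pi fun i ↦ continuous_pi fun j ↦ ?_
      exact continuousOn_univ.1 (hlin i j).continuousOn
    exact isOpen_ne_fun h continuous_const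
  have h0 : (0 : Mod n) ∈ s := by
    change (C * (0 : Matrix (Fin n) (Fin 2) ℂ) + D).det ≠ 0
    simpa using hD
  have hinv : EntrySmooth s fun Y : Mod n ↦ (C * of Y + D)⁻¹ :=
    EntrySmooth.inv (fun i j ↦ (hlin i j).mono (Set.subset_univ _)) fun X hX ↦ hX
  set E := A - B * D⁻¹ * C with hE
  have hev : (fun Y : Mod n ↦ (Matrix.of.symm ((A * of Y + B) * (C * of Y + D)⁻¹) : Mod n)) =ᶠ[nhds 0]
      fun Y ↦ fun i j ↦ (B * D⁻¹) i j + ∑ k, mulLR E 1 Y i k * (C * of Y + D)⁻¹ k j := by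
    filter_upwards [hopen.mem_nhds h0] with Y hY
    have hu : IsUnit (C * of Y + D).det := IsUnit.mk0 _ hY
    -- Splitting off the value B D⁻¹ at 0 leaves E Y (CY + D)⁻¹, whose first factor is linear in Y.
    have h1 : A * of Y + B = B * D⁻¹ * (C * of Y + D) + E * of Y := by
      rw [hE, Matrix.sub_mul, Matrix.mul_add, Matrix.nonsing_inv_mul_cancel_right _ _ hD.isUnit]
      simp only [Matrix.mul_assoc]
      abel
    have h2 : (A * of Y + B) * (C * of Y + D)⁻¹ = B * D⁻¹ + (E * of Y * (1 : Matrix (Fin 2) (Fin 2) ℂ)) * (C * of Y + D)⁻¹ := by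
      rw [h1, Matrix.add_mul, Matrix.mul_nonsing_inv_cancel_right _ _ hu, Matrix.mul_one]
    funext i j
    change ((A * of Y + B) * (C * of Y + D)⁻¹) i j = _
    rw [h2, Matrix.add_apply, Matrix.mul_apply]
    rfl
  refine HasFDerivAt.congr_of_eventuallyEq ?_ hev
  rw [hasFDerivAt_pi']
  intro i
  rw [hasFDerivAt_pi']
  intro j
  have hk : ∀ k, HasFDerivAt (fun Y : Mod n ↦ mulLR E 1 Y i k * (C * of Y + D)⁻¹ k j)
      ((D⁻¹ k j) • ((ContinuousLinearMap.proj k).comp ((ContinuousLinearMap.proj i).comp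
        (mulLR (n := n) E 1)) : Mod n →L[ℝ] ℂ)) 0 := by
    intro k
    have ha : HasFDerivAt (fun Y : Mod n ↦ mulLR E 1 Y i k)
      ((ContinuousLinearMap.proj k).comp ((ContinuousLinearMap.proj i).comp
        (mulLR (n := n) E 1)) : Mod n →L[ℝ] ℂ) 0 :=
      ((ContinuousLinearMap.proj k).comp ((ContinuousLinearMap.proj i).comp
        (mulLR (n := n) E 1)) : Mod n →L[ℝ] ℂ).hasFDerivAt
    -- The derivative `q` of the inverse need not be known: in the product rule it is multiplied by
    -- the linear factor, which vanishes at 0.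
    obtain ⟨q, hb⟩ : ∃ q, HasFDerivAt (fun Y : Mod n ↦ (C * of Y + D)⁻¹ k j) q 0 :=
      ((hinv k j).contDiffAt (hopen.mem_nhds h0)).differentiableAt (by simp)
    have h := ha.mul hb
    refine h.congr_fderiv ?_
    have e1 : mulLR E 1 (0 : Mod n) i k = 0 := by rw [map_zero]; rfl
    have e2 : (C * of (0 : Mod n) + D)⁻¹ = D⁻¹ := by
      change (C * (0 : Matrix (Fin n) (Fin 2) ℂ) + D)⁻¹ = D⁻¹
      simp
    rw [e1, e2]
    exact (congrArg₂ (· + ·) (zero_smul ℂ q) rfl).trans (zero_add _)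
  have hsum := (HasFDerivAt.fun_sum (u := Finset.univ) fun k _ ↦ hk k).const_add ((B * D⁻¹) i j)
  refine hsum.congr_fderiv ?_
  ext v
  simp only [_root_.sum_apply, _root_.smul_apply, smul_eq_mul]
  change ∑ k, D⁻¹ k j * (E * of v * (1 : Matrix (Fin 2) (Fin 2) ℂ)) i k = (E * of v * D⁻¹) i j
  rw [Matrix.mul_one, Matrix.mul_apply]
  exact Finset.sum_congr rfl fun k _ ↦ mul_comm _ _

/-- The projection onto a graph factors as (X; 1) N (X; 1)* with N = `gramInv X`, and U sends the
column (X; 1) to (AX + B; CX + D). -/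
theorem conj_graphProj_blocks {n : ℕ} (U : BMat n) (X : Matrix (Fin n) (Fin 2) ℂ) :
    (U * graphProj X * Uᴴ).toBlocks₁₂ = (U.toBlocks₁₁ * X + U.toBlocks₁₂) * gramInv X *
        (U.toBlocks₂₁ * X + U.toBlocks₂₂)ᴴ ∧
      (U * graphProj X * Uᴴ).toBlocks₂₂ = (U.toBlocks₂₁ * X + U.toBlocks₂₂) * gramInv X *
        (U.toBlocks₂₁ * X + U.toBlocks₂₂)ᴴ := by
  conv => 
    congr 
    · lhs; rw [← fromBlocks_toBlocks U]
    · lhs; rw [← fromBlocks_toBlocks U]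
  rw [graphProj, fromBlocks_conjTranspose, fromBlocks_multiply, fromBlocks_multiply,
    toBlocks_fromBlocks₁₂, toBlocks_fromBlocks₂₂]
  simp only [conjTranspose_add, conjTranspose_mul, Matrix.mul_add, Matrix.add_mul,
    Matrix.mul_assoc]
  exact ⟨trivial, trivial⟩

theorem shiftProj_smul_symm {n : ℕ} (g g' s : SU n) (X : Mod n) :
    shiftProj g' (s • (graphChart g).symm X) =
      (g'⁻¹ * s * g).1 * graphProj (of X) * ((g'⁻¹ * s * g).1)ᴴ := by
  have h : shiftProj g ((graphChart g).symm X) = graphProj (Matrix.of X) :=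
    (exists_shiftProj_eq g (Matrix.of X)).choose_spec
  have hU : (g'⁻¹ * s * g).1 = g'.1ᴴ * s.1 * g.1 := rfl
  rw [shiftProj, toProj_smul, toProj_eq_shift g, h, hU]
  simp only [conjTranspose_mul, conjTranspose_conjTranspose, Matrix.mul_assoc]

/-- The action of the group in graph coordinates: a Möbius transformation. -/
theorem graphCoord_smul_symm {n : ℕ} (g g' s : SU n) (X : Mod n)
    (h : ((g'⁻¹ * s * g).1.toBlocks₂₁ * of X + (g'⁻¹ * s * g).1.toBlocks₂₂).det ≠ 0) :
    graphCoord g' (s • (graphChart g).symm X) =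
      ((g'⁻¹ * s * g).1.toBlocks₁₁ * of X + (g'⁻¹ * s * g).1.toBlocks₁₂) *
      ((g'⁻¹ * s * g).1.toBlocks₂₁ * of X + (g'⁻¹ * s * g).1.toBlocks₂₂)⁻¹ := by
  rw [graphCoord, shiftProj_smul_symm]
  generalize (g'⁻¹ * s * g).1 = U at *
  obtain ⟨h1, h2⟩ := conj_graphProj_blocks U (of X)
  rw [h1, h2]
  set P := U.toBlocks₁₁ * of X + U.toBlocks₁₂
  set R := U.toBlocks₂₁ * of X + U.toBlocks₂₂
  have hN := unit_gramInv (of X)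
  have hR' : IsUnit (Rᴴ).det := by
    rw [det_conjTranspose]; exact h.isUnit.star
  -- The coordinate is the quotient of P N R* by R N R*, in which N R* cancels.
  rw [Matrix.mul_inv_rev, Matrix.mul_inv_rev]
  calc P * gramInv (of X) * Rᴴ * (Rᴴ⁻¹ * ((gramInv (of X))⁻¹ * R⁻¹))
      = P * gramInv (of X) * (Rᴴ * Rᴴ⁻¹) * (gramInv (of X))⁻¹ * R⁻¹ := by
        simp only [Matrix.mul_assoc]
    _ = P * R⁻¹ := by
        rw [mul_nonsing_inv _ hR', Matrix.mul_one, mul_nonsing_inv_cancel_right _ _ hN]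

end Transitions
-- Differentials of the charts and of the action
section Differentials
open Matrix

theorem mk_out {n : ℕ} (x : SymSpace n) : (QuotientGroup.mk x.out : SymSpace n) = x :=
  QuotientGroup.out_eq' x

theorem chartAt_source {n : ℕ} (x : SymSpace n) :
    (chartAt (Mod n) x).source = {y | (shiftProj x.out y).toBlocks₂₂.det ≠ 0} := rfl

/-- The group element which passes from the chart at `y` to the chart at `x`. -/
noncomputable def transit {n : ℕ} (x y : SymSpace n) : SU n := x.out⁻¹ * y.out

theorem shiftProj_eq_transit {n : ℕ} (x y : SymSpace n) :
    shiftProj x.out y = (transit x y).1 * baseProj n * (transit x y).1ᴴ := by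
  conv_lhs => rw [← mk_out y, shiftProj_eq]
  rfl

theorem det_transit_ne {n : ℕ} {x y : SymSpace n} (hy : y ∈ (chartAt (Mod n) x).source) :
    (transit x y).1.toBlocks₂₂.det ≠ 0 := by
  rw [chartAt_source, Set.mem_ofPred_eq] at hy
  conv at hy => rw [← mk_out y, det_shiftProj_mk]
  exact left_ne_zero_of_mul hy

theorem graphCoord_self {n : ℕ} (x : SymSpace n) : graphCoord x.out x = 0 := by
  have h : shiftProj x.out x = graphProj (0 : Matrix (Fin n) (Fin 2) ℂ) := by
    rw [shiftProj_eq_transit, transit, inv_mul_cancel]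
    change (1 : BMat n) * baseProj n * (1 : BMat n)ᴴ = _
    simp [graphProj, gramInv, baseProj]
  exact graphCoord_of_shiftProj h

theorem extChartAt_apply {n : ℕ} (x y : SymSpace n) :
    extChartAt 𝓘(ℝ, Mod n) x y = Matrix.of.symm (graphCoord x.out y) := rfl

theorem extChartAt_self {n : ℕ} (x : SymSpace n) : extChartAt 𝓘(ℝ, Mod n) x x = 0 := by
  rw [extChartAt_apply, graphCoord_self]; rfl

theorem extChartAt_target_eq {n : ℕ} (x : SymSpace n) :
    (extChartAt 𝓘(ℝ, Mod n) x).target = Set.univ := by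
  rw [extChartAt_target]
  change _ ⁻¹' Set.univ ∩ _ = _
  simp

theorem extChartAt_symm_apply {n : ℕ} (x : SymSpace n) (X : Mod n) :
    (extChartAt 𝓘(ℝ, Mod n) x).symm X = (graphChart x.out).symm X := rfl

/-- The action of `s` between the charts at `x` and `y`, near the centre of the chart at `x`. -/
theorem hasFDerivAt_action {n : ℕ} (x y : SymSpace n) (s : SU n)
    (hD : (y.out⁻¹ * s * x.out).1.toBlocks₂₂.det ≠ 0) :
    HasFDerivAt (fun X : Mod n ↦ (Matrix.of.symm (graphCoord y.out
        (s • (extChartAt 𝓘(ℝ, Mod n) x).symm X)) : Mod n))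
      (mulLR ((y.out⁻¹ * s * x.out).1.toBlocks₁₁ - (y.out⁻¹ * s * x.out).1.toBlocks₁₂ *
        ((y.out⁻¹ * s * x.out).1.toBlocks₂₂)⁻¹ * (y.out⁻¹ * s * x.out).1.toBlocks₂₁)
        ((y.out⁻¹ * s * x.out).1.toBlocks₂₂)⁻¹) 0 := by
  refine (hasFDerivAt_moebius _ _ _ _ hD).congr_of_eventuallyEq ?_
  have hopen : IsOpen {X : Mod n | ((y.out⁻¹ * s * x.out).1.toBlocks₂₁ * of X +
      (y.out⁻¹ * s * x.out).1.toBlocks₂₂).det ≠ 0} := by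
    have h : Continuous fun X : Mod n ↦ ((y.out⁻¹ * s * x.out).1.toBlocks₂₁ * of X +
      (y.out⁻¹ * s * x.out).1.toBlocks₂₂).det :=
      Continuous.matrix_det ((continuous_const.matrix_mul continuous_id).add continuous_const)
    exact isOpen_ne_fun h continuous_const
  have h0 : (0 : Mod n) ∈ {X : Mod n | ((y.out⁻¹ * s * x.out).1.toBlocks₂₁ * of X +
      (y.out⁻¹ * s * x.out).1.toBlocks₂₂).det ≠ 0} := by
    have hz : of (0 : Mod n) = (0 : Matrix (Fin n) (Fin 2) ℂ) := rfl
    rw [Set.mem_ofPred_eq, hz, Matrix.mul_zero, zero_add]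
    exact hD
  filter_upwards [hopen.mem_nhds h0] with X hX
  rw [extChartAt_symm_apply, graphCoord_smul_symm _ _ _ _ hX]

/-- The inverse of the Schur complement in a unitary matrix. -/
theorem conjTranspose_mul_schur {n : ℕ} (U : SU n) (hD : U.1.toBlocks₂₂.det ≠ 0) :
    (U.1.toBlocks₁₁)ᴴ * (U.1.toBlocks₁₁ - U.1.toBlocks₁₂ * (U.1.toBlocks₂₂)⁻¹ *
      U.1.toBlocks₂₁) = 1 := by
  have h := U.conj_mul
  generalize U.1 = W at *
  rw [← fromBlocks_toBlocks W, fromBlocks_conjTranspose, fromBlocks_multiply,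
    ← fromBlocks_one, fromBlocks_inj] at h
  obtain ⟨h1, h2, -, -⟩ := h
  -- Orthogonality of the two block columns turns A*B D⁻¹C into −C*C, and A*A + C*C = 1.
  have h3 : (W.toBlocks₁₁)ᴴ * W.toBlocks₁₂ = -((W.toBlocks₂₁)ᴴ * W.toBlocks₂₂) :=
    eq_neg_of_add_eq_zero_left h2
  rw [Matrix.mul_sub, Matrix.mul_assoc, ← Matrix.mul_assoc _ W.toBlocks₁₂, h3, Matrix.neg_mul,
    Matrix.mul_assoc, ← Matrix.mul_assoc W.toBlocks₂₂, mul_nonsing_inv _ hD.isUnit,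
    Matrix.one_mul, sub_neg_eq_add, h1]

/-- The differential at `y` of the chart at `x`, as a map of `n × 2` matrices. -/
noncomputable def toChart {n : ℕ} (x y : SymSpace n) : Mod n →L[ℝ] Mod n :=
  mulLR ((transit x y).1.toBlocks₁₁ - (transit x y).1.toBlocks₁₂ *
    ((transit x y).1.toBlocks₂₂)⁻¹ * (transit x y).1.toBlocks₂₁) ((transit x y).1.toBlocks₂₂)⁻¹

/-- The inverse of the differential at `y` of the chart at `x`. -/
noncomputable def fromChart {n : ℕ} (x y : SymSpace n) : Mod n →L[ℝ] Mod n :=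
  mulLR ((transit x y).1.toBlocks₁₁)ᴴ (transit x y).1.toBlocks₂₂

theorem fromChart_mul_toChart {n : ℕ} {x y : SymSpace n} (hy : y ∈ (chartAt (Mod n) x).source) :
    fromChart x y * toChart x y = 1 := by
  have hD := det_transit_ne hy
  rw [fromChart, toChart, mulLR_mul, conjTranspose_mul_schur _ hD, nonsing_inv_mul _ hD.isUnit,
    mulLR_one]

theorem toChart_mul_fromChart {n : ℕ} {x y : SymSpace n} (hy : y ∈ (chartAt (Mod n) x).source) :
    toChart x y * fromChart x y = 1 := by
  have hD := det_transit_ne hy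
  rw [fromChart, toChart, mulLR_mul, mul_eq_one_comm.1 (conjTranspose_mul_schur _ hD),
    mul_nonsing_inv _ hD.isUnit, mulLR_one]

theorem mfderiv_chart {n : ℕ} {x y : SymSpace n} (hy : y ∈ (chartAt (Mod n) x).source) :
    mfderiv 𝓘(ℝ, Mod n) 𝓘(ℝ, Mod n) (extChartAt 𝓘(ℝ, Mod n) x) y = toChart x y := by
  refine HasMFDerivAt.mfderiv ⟨continuousAt_extChartAt' (by simpa using hy), ?_⟩
  -- The chart at `x` in the coordinates centred at `y` is the action of the identity from one chart
  -- to the other.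
  have h := hasFDerivAt_action y x 1 (by rw [mul_one]; exact det_transit_ne hy)
  rw [mul_one] at h
  simp only [one_smul] at h
  rw [extChartAt_self]
  exact h.hasFDerivWithinAt

/-- Together with `symmL_eq` this translates the trivializations of the tangent bundle into explicit
matrix multiplications, so that smoothness of sections becomes smoothness of matrix entries. -/
theorem continuousLinearMapAt_eq {n : ℕ} {x y : SymSpace n}
    (hy : y ∈ (chartAt (Mod n) x).source) :
    (trivializationAt (Mod n) (TangentSpace 𝓘(ℝ, Mod n)) x).continuousLinearMapAt ℝ y =
      toChart x y := by
  rw [TangentBundle.continuousLinearMapAt_trivializationAt hy, mfderiv_chart hy]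

theorem symmL_eq {n : ℕ} {x y : SymSpace n} (hy : y ∈ (chartAt (Mod n) x).source) :
    (trivializationAt (Mod n) (TangentSpace 𝓘(ℝ, Mod n)) x).symmL ℝ y = fromChart x y := by
  have hb : y ∈ (trivializationAt (Mod n) (TangentSpace 𝓘(ℝ, Mod n)) x).baseSet := by simpa using hy
  refine ContinuousLinearMap.ext fun v ↦ ?_
  have h1 := congrArg (fun f : Mod n →L[ℝ] Mod n ↦ f v) (toChart_mul_fromChart hy)
  have h2 := (trivializationAt (Mod n) (TangentSpace 𝓘(ℝ, Mod n)) x).symmL_continuousLinearMapAt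
    (R := ℝ) hb (fromChart x y v)
  rw [continuousLinearMapAt_eq hy] at h2
  refine Eq.trans ?_ h2
  exact congrArg _ h1.symm

theorem mfderiv_chart_symm {n : ℕ} {x y : SymSpace n} (hy : y ∈ (chartAt (Mod n) x).source) :
    mfderiv 𝓘(ℝ, Mod n) 𝓘(ℝ, Mod n) (extChartAt 𝓘(ℝ, Mod n) x).symm
      (extChartAt 𝓘(ℝ, Mod n) x y) = fromChart x y := by
  rw [← symmL_eq hy, TangentBundle.symmL_trivializationAt hy, ModelWithCorners.range_eq_univ,
    mfderivWithin_univ]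

/-- Both `(s • x).out` and `s * x.out` represent the coset `s • x`. -/
theorem inv_mul_mul_mem {n : ℕ} (s : SU n) (x : SymSpace n) :
    (s • x).out⁻¹ * s * x.out ∈ blockDiag n := by
  rw [mul_assoc, ← QuotientGroup.eq, mk_out]
  conv_lhs => rw [← mk_out x]
  rfl

theorem blockDiag_unitary {n : ℕ} {U : SU n} (hU : U ∈ blockDiag n) :
    U.1.toBlocks₂₂ * (U.1.toBlocks₂₂)ᴴ = 1 ∧ (U.1.toBlocks₁₁)ᴴ * U.1.toBlocks₁₁ = 1 := by
  obtain ⟨h12, h21⟩ := hU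
  have h := U.mul_conj
  have h' := U.conj_mul
  generalize U.1 = W at *
  rw [← fromBlocks_toBlocks W, h12, h21, fromBlocks_conjTranspose, fromBlocks_multiply,
    ← fromBlocks_one, fromBlocks_inj] at h h'
  exact ⟨by simpa using h.2.2.2, by simpa using h'.1⟩

/-- The differential of the action, in the tangent coordinates of the two points. -/
theorem mfderiv_action {n : ℕ} (s : SU n) (x : SymSpace n) :
    mfderiv 𝓘(ℝ, Mod n) 𝓘(ℝ, Mod n) (fun y : SymSpace n ↦ s • y) x =
      mulLR ((s • x).out⁻¹ * s * x.out).1.toBlocks₁₁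
        (((s • x).out⁻¹ * s * x.out).1.toBlocks₂₂)ᴴ := by
  have hU := inv_mul_mul_mem s x
  obtain ⟨h1, -⟩ := blockDiag_unitary hU
  have hD : ((s • x).out⁻¹ * s * x.out).1.toBlocks₂₂.det ≠ 0 := by
    intro h0
    have := congrArg Matrix.det h1
    rw [det_mul, h0, zero_mul, det_one] at this
    exact zero_ne_one this
  refine HasMFDerivAt.mfderiv ⟨(continuous_const_smul s).continuousAt, ?_⟩
  have h := hasFDerivAt_action x (s • x) s hD
  -- The transition element is block diagonal, so the Schur complement reduces to A and D⁻¹ = D*.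
  rw [inv_eq_right_inv h1, hU.1, Matrix.zero_mul, Matrix.zero_mul, sub_zero] at h
  rw [extChartAt_self]
  exact h.hasFDerivWithinAt

/-- The coordinates of `y` in the chart at `x` determine the Gram matrices of the transition. -/
theorem transit_gram {n : ℕ} {x y : SymSpace n} (hy : y ∈ (chartAt (Mod n) x).source) :
    (transit x y).1.toBlocks₂₂ * ((transit x y).1.toBlocks₂₂)ᴴ = gramInv (graphCoord x.out y) ∧
      (transit x y).1.toBlocks₁₁ * ((transit x y).1.toBlocks₁₁)ᴴ =
        1 - graphCoord x.out y * gramInv (graphCoord x.out y) * (graphCoord x.out y)ᴴ := by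
  have h := shiftProj_graphCoord hy
  rw [shiftProj_eq_transit] at h
  have hU := (transit x y).mul_conj
  generalize (transit x y).1 = W at *
  rw [← fromBlocks_toBlocks W, conj_baseProj, graphProj, fromBlocks_inj] at h
  rw [← fromBlocks_toBlocks W, fromBlocks_conjTranspose, fromBlocks_multiply,
    ← fromBlocks_one, fromBlocks_inj] at hU
  exact ⟨h.2.2.2, by rw [← h.1]; exact eq_sub_of_add_eq hU.1⟩

end Differentials
-- The fibres of the quaternionic family and a root of the Gram matrix
section QuaternionicFrames
open Matrix
open scoped ComplexOrder

/-- The Lie algebra of `SU(2)`. -/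
def su2 : Submodule ℝ (Matrix (Fin 2) (Fin 2) ℂ) where
  carrier := {T | Tᴴ = -T ∧ T.trace = 0}
  add_mem' := by
    rintro S T ⟨h1, h2⟩ ⟨h3, h4⟩
    exact ⟨by rw [conjTranspose_add, h1, h3, neg_add], by rw [trace_add, h2, h4, add_zero]⟩
  zero_mem' := by simp
  smul_mem' := by
    rintro c T ⟨h1, h2⟩
    exact ⟨by rw [conjTranspose_smul, h1, smul_neg, star_trivial],
      by rw [trace_smul, h2, smul_zero]⟩

/-- The quaternion unit `i` as a complex matrix. -/
def unitI : Matrix (Fin 2) (Fin 2) ℂ := !![Complex.I, 0; 0, -Complex.I]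
/-- The quaternion unit `j` as a complex matrix. -/
def unitJ : Matrix (Fin 2) (Fin 2) ℂ := !![0, 1; -1, 0]
/-- The quaternion unit `k` as a complex matrix. -/
def unitK : Matrix (Fin 2) (Fin 2) ℂ := !![0, Complex.I; Complex.I, 0]

theorem unitI_mul_unitJ : unitI * unitJ = unitK := by simp [unitI, unitJ, unitK]
theorem unitJ_mul_unitI : unitJ * unitI = -unitK := by
  ext i j; fin_cases i <;> fin_cases j <;> simp [unitI, unitJ, unitK]
theorem unitI_sq : unitI * unitI = -1 := by
  ext i j; fin_cases i <;> fin_cases j <;> simp [unitI]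
theorem unitJ_sq : unitJ * unitJ = -1 := by
  ext i j; fin_cases i <;> fin_cases j <;> simp [unitJ]
theorem unitK_sq : unitK * unitK = -1 := by
  ext i j; fin_cases i <;> fin_cases j <;> simp [unitK]
theorem unitI_conj : unitIᴴ = -unitI := by
  ext i j; fin_cases i <;> fin_cases j <;> simp [unitI]
theorem unitJ_conj : unitJᴴ = -unitJ := by
  ext i j; fin_cases i <;> fin_cases j <;> simp [unitJ]
theorem unitK_conj : unitKᴴ = -unitK := by
  ext i j; fin_cases i <;> fin_cases j <;> simp [unitK]

theorem su2_eq_span : su2 = Submodule.span ℝ {unitI, unitJ, unitK} := by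
  apply le_antisymm
  · rintro T ⟨h1, h2⟩
    have h00 := congrFun (congrFun h1 0) 0
    have h01 := congrFun (congrFun h1 1) 0
    rw [trace_fin_two] at h2
    simp only [conjTranspose_apply, Matrix.neg_apply, Complex.star_def] at h00 h01
    have hT : T = (T 0 0).im • unitI + (T 0 1).re • unitJ + (T 0 1).im • unitK := by
      ext i j
      fin_cases i <;> fin_cases j <;>
        simp [unitI, unitJ, unitK, Complex.ext_iff] at h00 h01 h2 ⊢ <;>
        first | linarith | (constructor <;> linarith)
    rw [hT]
    refine add_mem (add_mem ?_ ?_) ?_ <;>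
      exact Submodule.smul_mem _ _ (Submodule.subset_span (by simp))
  · rw [Submodule.span_le]
    rintro T (rfl | rfl | rfl)
    · exact ⟨unitI_conj, by simp [unitI, trace_fin_two]⟩
    · exact ⟨unitJ_conj, by simp [unitJ, trace_fin_two]⟩
    · exact ⟨unitK_conj, by simp [unitK, trace_fin_two]⟩

/-- The factor `c` is allowed because the frame below is unitary only up to a scalar; vanishing of
the trace survives scaling. -/
theorem conj_mem_su2 {W T : Matrix (Fin 2) (Fin 2) ℂ} {c : ℂ} (hW : Wᴴ * W = c • 1)
    (hT : T ∈ su2) : W * T * Wᴴ ∈ su2 := by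
  obtain ⟨h1, h2⟩ := hT
  refine ⟨?_, ?_⟩
  · simp only [conjTranspose_mul, conjTranspose_conjTranspose, h1, Matrix.mul_assoc,
      Matrix.mul_neg, Matrix.neg_mul]
  · rw [trace_mul_comm, ← Matrix.mul_assoc, hW, Matrix.smul_mul, Matrix.one_mul, trace_smul, h2,
      smul_zero]

/-- Since S² = −1, the inverse of S is −S; by unitarity it is also S*, and by det S = 1 it is the
adjugate. The first makes S skew-Hermitian; the second, read off at a diagonal entry, makes it
traceless. -/
theorem su2_of_sq {S : Matrix.specialUnitaryGroup (Fin 2) ℂ} (hS : S.1 * S.1 = -1) :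
    S.1ᴴ ∈ su2 := by
  have h1 : S.1ᴴ * S.1 = 1 := S.2.1.1
  have hd : S.1.det = 1 := S.2.2
  have h2 : S.1ᴴ = -S.1 := by
    refine left_inv_eq_right_inv h1 ?_
    rw [Matrix.mul_neg, hS, neg_neg]
  have h3 : S.1.adjugate = -S.1 := by
    refine left_inv_eq_right_inv (a := S.1) ?_ ?_
    · rw [adjugate_mul, hd, one_smul]
    · rw [Matrix.mul_neg, hS, neg_neg]
  have h4 := congrFun (congrFun h3 0) 0
  rw [adjugate_fin_two] at h4
  simp only [of_apply, cons_val', cons_val_zero, Matrix.neg_apply] at h4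
  have htr : S.1.trace = 0 := by
    rw [trace_fin_two, h4, add_neg_cancel]
  rw [h2, neg_mem_iff]
  exact ⟨h2, htr⟩

theorem inclSU2_mem (n : ℕ) (S : Matrix.specialUnitaryGroup (Fin 2) ℂ) :
    inclSU2 n S ∈ blockDiag n := by
  constructor
  · exact toBlocks_fromBlocks₁₂ _ _ _ _
  · exact toBlocks_fromBlocks₂₁ _ _ _ _

theorem inclSU2_smul {n : ℕ} (k : SU n) (S : Matrix.specialUnitaryGroup (Fin 2) ℂ)
    {x : SymSpace n} (hk : (QuotientGroup.mk k : SymSpace n) = x) :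
    (k * inclSU2 n S * k⁻¹) • x = x := by
  subst hk
  change (QuotientGroup.mk (k * inclSU2 n S * k⁻¹ * k) : SymSpace n) = _
  rw [inv_mul_cancel_right, eq_comm, QuotientGroup.eq, inv_mul_cancel_left]
  exact inclSU2_mem n S

/-- A representative `k` differs from `x.out` by a block diagonal element, and conjugation by it
fixes the upper block 1 and changes S by its unitary lower block. Hence the choice of `k` does not
affect the span. -/
theorem isotropyMap_eq {n : ℕ} (k : SU n) (S : Matrix.specialUnitaryGroup (Fin 2) ℂ)
    {x : SymSpace n} (hk : (QuotientGroup.mk k : SymSpace n) = x)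
    (hs : (k * inclSU2 n S * k⁻¹) • x = x) :
    isotropyMap (k * inclSU2 n S * k⁻¹) x hs =
      rightMul n ((x.out⁻¹ * k).1.toBlocks₂₂ * S.1ᴴ * ((x.out⁻¹ * k).1.toBlocks₂₂)ᴴ) := by
  refine (mfderiv_action (k * inclSU2 n S * k⁻¹) x).trans ?_
  rw [hs, rightMul_apply]
  have hmem : x.out⁻¹ * k ∈ blockDiag n := by
    rw [← QuotientGroup.eq, mk_out, hk]
  have hU : (x.out⁻¹ * (k * inclSU2 n S * k⁻¹) * x.out).1 =
      (x.out⁻¹ * k).1 * fromBlocks 1 0 0 S.1 * ((x.out⁻¹ * k).1)ᴴ := by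
    have : x.out⁻¹ * (k * inclSU2 n S * k⁻¹) * x.out =
      (x.out⁻¹ * k) * inclSU2 n S * (x.out⁻¹ * k)⁻¹ := by group
    rw [this]; rfl
  rw [hU]
  have h1 := (x.out⁻¹ * k).mul_conj
  obtain ⟨h12, h21⟩ := hmem
  generalize (x.out⁻¹ * k).1 = W at *
  rw [← fromBlocks_toBlocks W, h12, h21, fromBlocks_conjTranspose, fromBlocks_multiply,
    ← fromBlocks_one, fromBlocks_inj] at h1
  have hW : W = fromBlocks W.toBlocks₁₁ 0 0 W.toBlocks₂₂ := by
    conv_lhs => rw [← fromBlocks_toBlocks W, h12, h21]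
  have hA : W.toBlocks₁₁ * (W.toBlocks₁₁)ᴴ = 1 := by simpa using h1.1
  have hprod : W * fromBlocks 1 0 0 S.1 * Wᴴ =
      fromBlocks 1 0 0 (W.toBlocks₂₂ * S.1 * (W.toBlocks₂₂)ᴴ) := by
    conv_lhs => rw [hW]
    rw [fromBlocks_conjTranspose, fromBlocks_multiply, fromBlocks_multiply]
    simp [hA]
  rw [hprod, toBlocks_fromBlocks₁₁, toBlocks_fromBlocks₂₂]
  simp only [conjTranspose_mul, conjTranspose_conjTranspose, Matrix.mul_assoc]
  rfl

theorem isotropyMap_out {n : ℕ} (x : SymSpace n) (S : Matrix.specialUnitaryGroup (Fin 2) ℂ)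
    (hs : (x.out * inclSU2 n S * x.out⁻¹) • x = x) :
    isotropyMap (x.out * inclSU2 n S * x.out⁻¹) x hs = rightMul n S.1ᴴ := by
  rw [isotropyMap_eq _ _ (mk_out x), inv_mul_cancel]
  have h : (1 : SU n).1.toBlocks₂₂ = 1 := by
    change (1 : BMat n).toBlocks₂₂ = 1
    rw [← fromBlocks_one, toBlocks_fromBlocks₂₂]
  rw [h, Matrix.one_mul, conjTranspose_one, Matrix.mul_one]

/-- The elements of `SU(2)` with square `-1` given by the quaternion units. -/
theorem exists_specialUnitary_of_unit {T : Matrix (Fin 2) (Fin 2) ℂ} (h1 : Tᴴ = -T)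
    (h2 : T * T = -1) (h3 : T.det = 1) :
    ∃ S : Matrix.specialUnitaryGroup (Fin 2) ℂ, S.1 * S.1 = -1 ∧ S.1ᴴ = T := by
  have hd : (Tᴴ).det = 1 := by rw [det_conjTranspose, h3, star_one]
  refine ⟨⟨Tᴴ, Matrix.mem_unitaryGroup_iff'.2 ?_, hd⟩, ?_, conjTranspose_conjTranspose T⟩
  · rw [star_eq_conjTranspose, conjTranspose_conjTranspose, h1, Matrix.mul_neg, h2, neg_neg]
  · change Tᴴ * Tᴴ = -1
    rw [h1, Matrix.neg_mul, Matrix.mul_neg, neg_neg, h2]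

theorem exists_unit (T : Matrix (Fin 2) (Fin 2) ℂ) (hT : T = unitI ∨ T = unitJ ∨ T = unitK) :
    ∃ S : Matrix.specialUnitaryGroup (Fin 2) ℂ, S.1 * S.1 = -1 ∧ S.1ᴴ = T := by
  rcases hT with rfl | rfl | rfl
  · exact exists_specialUnitary_of_unit unitI_conj unitI_sq (by simp [unitI, det_fin_two])
  · exact exists_specialUnitary_of_unit unitJ_conj unitJ_sq (by simp [unitJ, det_fin_two])
  · exact exists_specialUnitary_of_unit unitK_conj unitK_sq (by simp [unitK, det_fin_two])

theorem map_rightMul_su2 (n : ℕ) :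
    su2.map (rightMul n) = Submodule.span ℝ (rightMul n '' {unitI, unitJ, unitK}) := by
  rw [su2_eq_span, Submodule.map_span]

theorem map_rightMul_su2_le {n : ℕ} {Q : Submodule ℝ (Mod n →L[ℝ] Mod n)}
    (h : ∀ T, T = unitI ∨ T = unitJ ∨ T = unitK → rightMul n T ∈ Q) :
    su2.map (rightMul n) ≤ Q := by
  rw [map_rightMul_su2, Submodule.span_le]
  rintro _ ⟨T, hT, rfl⟩
  exact h T hT

/-- Generators from any representative lie in su(2), which is stable under unitary conjugation;
conversely `k = x.out` with the three quaternion units already gives a basis of su(2). -/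
theorem quaternionicStructure_eq {n : ℕ} (x : SymSpace n) :
    quaternionicStructure n x = su2.map (rightMul n) := by
  apply le_antisymm
  · refine Submodule.span_le.2 ?_
    rintro _ ⟨k, S, hs, hk, hS, rfl⟩
    refine ⟨_, conj_mem_su2 (c := 1) ?_ (su2_of_sq hS), (isotropyMap_eq k S hk hs).symm⟩
    have hmem : x.out⁻¹ * k ∈ blockDiag n := by
      rw [← QuotientGroup.eq, mk_out, hk]
    rw [one_smul]
    exact mul_eq_one_comm.1 (blockDiag_unitary hmem).1
  · let Q : Submodule ℝ (Mod n →L[ℝ] Mod n) := quaternionicStructure n x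
    have h : su2.map (rightMul n) ≤ Q := by
      refine map_rightMul_su2_le fun T hT ↦ ?_
      change rightMul n T ∈ quaternionicStructure n x
      obtain ⟨S, hS, hST⟩ := exists_unit T hT
      refine Submodule.subset_span ⟨x.out, S, inclSU2_smul _ S (mk_out x), mk_out x, hS, ?_⟩
      rw [isotropyMap_out x S, hST]
    exact h

theorem isInvariant_quaternionicStructure (n : ℕ) :
    IsInvariantEndFamily (SU n) (quaternionicStructure n) := by
  intro a x A hA
  rw [quaternionicStructure_eq] at hA
  obtain ⟨T, hT, rfl⟩ := hA
  set U := (a • x).out⁻¹ * a * x.out with hU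
  obtain ⟨h1, -⟩ := blockDiag_unitary (inv_mul_mul_mem a x)
  rw [← hU] at h1
  have h2 := mul_eq_one_comm.1 h1
  -- The differential is v ↦ A v D*, and (A v D*)(D T D*) = A (v T) D* because D*D = 1.
  refine ⟨rightMul n (U.1.toBlocks₂₂ * T * (U.1.toBlocks₂₂)ᴴ), ?_, ?_⟩
  · rw [quaternionicStructure_eq]
    exact ⟨_, conj_mem_su2 (c := 1) (by rw [one_smul, h2]) hT, rfl⟩
  · intro v
    have hm := mfderiv_action a x
    rw [← hU] at hm
    rw [hm]
    have h : rightMul n (U.1.toBlocks₂₂ * T * (U.1.toBlocks₂₂)ᴴ) *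
        mulLR U.1.toBlocks₁₁ (U.1.toBlocks₂₂)ᴴ =
        mulLR U.1.toBlocks₁₁ (U.1.toBlocks₂₂)ᴴ * rightMul n T := by
      rw [rightMul_apply, rightMul_apply, mulLR_mul, mulLR_mul, Matrix.one_mul, Matrix.mul_one]
      congr 1
      rw [Matrix.mul_assoc U.1.toBlocks₂₂, ← Matrix.mul_assoc, h2, Matrix.one_mul]
    exact congrArg (fun f : Mod n →L[ℝ] Mod n ↦ f v) h

/-- The square root of the determinant of the Gram matrix. -/
noncomputable def gramRoot {n : ℕ} (X : Matrix (Fin n) (Fin 2) ℂ) : ℝ :=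
  Real.sqrt (1 + Xᴴ * X).det.re

theorem det_gram_pos {n : ℕ} (X : Matrix (Fin n) (Fin 2) ℂ) :
    0 < (1 + Xᴴ * X).det.re ∧ ((1 + Xᴴ * X).det.re : ℂ) = (1 + Xᴴ * X).det := by
  have h := (posDef_gram X).det_pos
  rw [Complex.lt_def] at h
  exact ⟨h.1, Complex.ext (by simp) (by simpa using h.2)⟩

theorem gramRoot_pos {n : ℕ} (X : Matrix (Fin n) (Fin 2) ℂ) : 0 < gramRoot X :=
  Real.sqrt_pos.2 (det_gram_pos X).1

theorem gramRoot_sq {n : ℕ} (X : Matrix (Fin n) (Fin 2) ℂ) :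
    (gramRoot X : ℂ) * gramRoot X = (1 + Xᴴ * X).det := by
  rw [← (det_gram_pos X).2, ← Complex.ofReal_mul, gramRoot,
    Real.mul_self_sqrt (det_gram_pos X).1.le]

/-- A multiple of the square root of `gramInv X`. -/
noncomputable def gramFrame {n : ℕ} (X : Matrix (Fin n) (Fin 2) ℂ) : Matrix (Fin 2) (Fin 2) ℂ :=
  (1 + Xᴴ * X).adjugate + (gramRoot X : ℂ) • 1

/-- For the 2 × 2 matrix P = 1 + X*X, with adjugate Q and r² = det P, Cayley–Hamilton gives (Q + r)²
= (tr P + 2r) Q, while Q = det P · P⁻¹. So Q + r is, up to a scalar, a square root of P⁻¹ that needs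
only the scalar square root of det P, whence its smoothness. -/
theorem gramFrame_mul_conj {n : ℕ} (X : Matrix (Fin n) (Fin 2) ℂ) :
    ∃ c : ℝ, c ≠ 0 ∧ gramFrame X * (gramFrame X)ᴴ = (c : ℂ) • gramInv X := by
  have hpd := posDef_gram X
  have hr := gramRoot_sq X
  have hrpos := gramRoot_pos X
  have hdet := det_gram_pos X
  set P := 1 + Xᴴ * X with hP
  set r := gramRoot X
  have hherm : (gramFrame X)ᴴ = gramFrame X := by
    rw [gramFrame, conjTranspose_add, adjugate_conjTranspose, hpd.1.eq, conjTranspose_smul,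
      conjTranspose_one, Complex.star_def, Complex.conj_ofReal]
  have htr : P.trace.im = 0 ∧ 0 < P.trace.re := by
    have := hpd.trace_pos
    rw [Complex.lt_def] at this
    exact ⟨this.2.symm, this.1⟩
  have htr' : ((P.trace.re : ℝ) : ℂ) = P.trace := Complex.ext (by simp) (by simp [htr.1])
  -- The factor tr P + 2r is from Cayley–Hamilton, the factor det P from passing from the adjugate
  -- to the inverse.
  refine ⟨(P.trace.re + 2 * r) * P.det.re, by have := htr.2; have := hdet.1; positivity, ?_⟩
  have hinv : gramInv X = (P.det)⁻¹ • P.adjugate := by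
    rw [gramInv, inv_def, Ring.inverse_eq_inv']
  have hne : P.det ≠ 0 := det_gram_ne X
  push_cast
  rw [hherm, hinv, smul_smul, htr', hdet.2, mul_assoc, mul_inv_cancel₀ hne, mul_one, gramFrame]
  change (P.adjugate + (r : ℂ) • 1) * (P.adjugate + (r : ℂ) • 1) = _
  rw [det_fin_two] at hr
  ext i j
  fin_cases i <;> fin_cases j <;>
    simp [adjugate_fin_two, Matrix.mul_apply, trace_fin_two, Fin.sum_univ_two] <;>
    first | ring1 | linear_combination hr

end QuaternionicFrames
-- Smooth local quaternionic frames
section Frames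
open Matrix
open scoped ComplexOrder

/-- Smoothness of a section may be tested in the single trivialization at `x`, where the field
becomes its conjugate by the differential of the chart. -/
theorem EndField.smoothAt_of_chart {n : ℕ} {A : EndField (Mod n) (SymSpace n)} {x : SymSpace n}
    {F : Mod n → Mod n →L[ℝ] Mod n} (hF : ContDiff ℝ ∞ F)
    (h : ∀ y ∈ (chartAt (Mod n) x).source,
      (toChart x y).comp ((A y : Mod n →L[ℝ] Mod n).comp (fromChart x y)) =
        F (extChartAt 𝓘(ℝ, Mod n) x y))
    {y : SymSpace n} (hy : y ∈ (chartAt (Mod n) x).source) : A.SmoothAt y := by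
  let e := trivializationAt (Mod n →L[ℝ] Mod n) (fun y : SymSpace n ↦
    TangentSpace 𝓘(ℝ, Mod n) y →L[ℝ] TangentSpace 𝓘(ℝ, Mod n) y) x
  have hb : y ∈ e.baseSet := by
    rw [hom_trivializationAt_baseSet]
    exact ⟨hy, hy⟩
  refine (e.contMDiffAt_section_iff hb).2 ?_
  have h2 : ContMDiffAt 𝓘(ℝ, Mod n) 𝓘(ℝ, Mod n →L[ℝ] Mod n) ∞
      (fun z : SymSpace n ↦ F (extChartAt 𝓘(ℝ, Mod n) x z)) y :=
    hF.contMDiff.contMDiffAt.comp y (contMDiffAt_extChartAt' hy)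
  refine h2.congr_of_eventuallyEq ?_
  filter_upwards [(chartAt (Mod n) x).open_source.mem_nhds hy] with z hz
  rw [← h z hz, hom_trivializationAt_apply]
  change (ContinuousLinearMap.comp _ (ContinuousLinearMap.comp _ _)) = _
  rw [continuousLinearMapAt_eq hz, symmL_eq hz]
  rfl

theorem contDiff_mulLR {n : ℕ} {E : Mod n → Matrix (Fin n) (Fin n) ℂ}
    {T : Mod n → Matrix (Fin 2) (Fin 2) ℂ} (hE : EntrySmooth Set.univ E)
    (hT : EntrySmooth Set.univ T) : ContDiff ℝ ∞ fun X ↦ mulLR (E X) (T X) := by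
  rw [contDiff_clm_apply_iff]
  intro v
  refine contDiff_pi.2 fun i ↦ contDiff_pi.2 fun j ↦ ?_
  exact contDiffOn_univ.1 (((hE.mul (EntrySmooth.const (of v))).mul hT) i j)

theorem entrySmooth_gram {n : ℕ} :
    EntrySmooth Set.univ fun X : Mod n ↦ 1 + (of X)ᴴ * of X := fun i j ↦
  contDiffOn_const.add (((entrySmooth_id (n := n)).conj.mul entrySmooth_id) i j)

theorem entrySmooth_gramInv {n : ℕ} :
    EntrySmooth Set.univ fun X : Mod n ↦ gramInv (of X) :=
  EntrySmooth.inv entrySmooth_gram fun _ _ ↦ det_gram_ne _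

theorem entrySmooth_gramFrame {n : ℕ} :
    EntrySmooth Set.univ fun X : Mod n ↦ gramFrame (of X) := by
  have hP := entrySmooth_gram (n := n)
  have hdet : ContDiffOn ℝ ∞ (fun X : Mod n ↦ (1 + (of X)ᴴ * of X).det) Set.univ := by
    simp only [det_fin_two]
    exact ((hP 0 0).mul (hP 1 1)).sub ((hP 0 1).mul (hP 1 0))
  have hroot : ContDiffOn ℝ ∞ (fun X : Mod n ↦ gramRoot (of X)) Set.univ :=
    ContDiffOn.sqrt (Complex.reCLM.contDiff.comp_contDiffOn hdet) fun _ _ ↦ (det_gram_pos _).1.ne'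
  have hroot' := Complex.ofRealCLM.contDiff.comp_contDiffOn hroot
  intro i j
  refine ContDiffOn.add (f := fun X : Mod n ↦ (1 + (of X)ᴴ * of X).adjugate i j) ?_
    (hroot'.mul contDiffOn_const)
  simp only [adjugate_fin_two]
  fin_cases i <;> fin_cases j
  · exact hP 1 1
  · exact (hP 0 1).neg
  · exact (hP 1 0).neg
  · exact hP 0 0

theorem det_gramFrame_ne {n : ℕ} (X : Matrix (Fin n) (Fin 2) ℂ) : (gramFrame X).det ≠ 0 := by
  obtain ⟨c, hc, h⟩ := gramFrame_mul_conj X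
  have h1 := congrArg Matrix.det h
  rw [det_mul, det_smul] at h1
  refine left_ne_zero_of_mul (b := (gramFrame X)ᴴ.det) ?_
  rw [h1]
  exact mul_ne_zero (pow_ne_zero _ (Complex.ofReal_ne_zero.2 hc)) (unit_gramInv X).ne_zero

/-- The matrix which carries the quaternion units to those of the smooth frame. -/
noncomputable def frameMatrix {n : ℕ} (x y : SymSpace n) : Matrix (Fin 2) (Fin 2) ℂ :=
  ((transit x y).1.toBlocks₂₂)⁻¹ * gramFrame (graphCoord x.out y)

/-- With G the Gram frame, G G* is a multiple of D D*, so D⁻¹G is a scalar multiple of a unitary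
matrix. -/
theorem frameMatrix_conj {n : ℕ} {x y : SymSpace n} (hy : y ∈ (chartAt (Mod n) x).source) :
    ∃ c : ℝ, c ≠ 0 ∧ frameMatrix x y * (frameMatrix x y)ᴴ = (c : ℂ) • 1 := by
  obtain ⟨c, hc, h⟩ := gramFrame_mul_conj (graphCoord x.out y)
  refine ⟨c, hc, ?_⟩
  obtain ⟨h1, -⟩ := transit_gram hy
  have hD := (det_transit_ne hy).isUnit
  set D := (transit x y).1.toBlocks₂₂
  have hD' : IsUnit (Dᴴ).det := by
    rw [det_conjTranspose]; exact hD.star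
  rw [frameMatrix, conjTranspose_mul, Matrix.mul_assoc, ← Matrix.mul_assoc (gramFrame _), h, ← h1,
    Matrix.smul_mul, Matrix.mul_smul, conjTranspose_nonsing_inv]
  congr 1
  rw [Matrix.mul_assoc, mul_nonsing_inv _ hD', Matrix.mul_one, nonsing_inv_mul _ hD]

theorem isUnit_det_frameMatrix {n : ℕ} {x y : SymSpace n}
    (hy : y ∈ (chartAt (Mod n) x).source) : IsUnit (frameMatrix x y).det := by
  rw [frameMatrix, det_mul, det_nonsing_inv]
  exact (det_transit_ne hy).isUnit.ringInverse.mul (det_gramFrame_ne _).isUnit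

theorem conj_frameMatrix_mem {n : ℕ} {x y : SymSpace n} (hy : y ∈ (chartAt (Mod n) x).source)
    {T : Matrix (Fin 2) (Fin 2) ℂ} (hT : T ∈ su2) :
    frameMatrix x y * T * (frameMatrix x y)⁻¹ ∈ su2 ∧
      (frameMatrix x y)⁻¹ * T * frameMatrix x y ∈ su2 := by
  obtain ⟨c, hc, h⟩ := frameMatrix_conj hy
  have hW := isUnit_det_frameMatrix hy
  set W := frameMatrix x y
  have hc' : (c : ℂ) ≠ 0 := Complex.ofReal_ne_zero.2 hc
  have hinv : W⁻¹ = (c⁻¹ : ℝ) • Wᴴ := by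
    refine inv_eq_right_inv ?_
    rw [Matrix.mul_smul, h]
    ext i j
    simp [hc]
  have h' : Wᴴ * W = (c : ℂ) • 1 := by
    have h1 := nonsing_inv_mul _ hW
    rw [hinv, Matrix.smul_mul] at h1
    rw [← h1]
    ext i j
    simp [hc]
  constructor
  · rw [hinv, Matrix.mul_smul]
    exact su2.smul_mem _ (conj_mem_su2 h' hT)
  · rw [hinv, Matrix.smul_mul, Matrix.smul_mul]
    have := conj_mem_su2 (W := Wᴴ) (c := c) (by rw [conjTranspose_conjTranspose, h]) hT
    rw [conjTranspose_conjTranspose] at this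
    exact su2.smul_mem _ this

/-- The smooth local field of endomorphisms determined by a complex `2 × 2` matrix. -/
noncomputable def frameField {n : ℕ} (x : SymSpace n) (T : Matrix (Fin 2) (Fin 2) ℂ) :
    EndField (Mod n) (SymSpace n) := fun y ↦
  rightMul n (frameMatrix x y * T * (frameMatrix x y)⁻¹)

theorem frameField_smoothAt {n : ℕ} {x y : SymSpace n} (T : Matrix (Fin 2) (Fin 2) ℂ)
    (hy : y ∈ (chartAt (Mod n) x).source) : (frameField x T).SmoothAt y := by
  have hF := contDiff_mulLR (n := n) (EntrySmooth.const 1)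
    (((entrySmooth_gramFrame (n := n)).mul (EntrySmooth.const T)).mul
      (EntrySmooth.inv entrySmooth_gramFrame fun _ _ ↦ det_gramFrame_ne _))
  refine EndField.smoothAt_of_chart (x := x) hF ?_ hy
  intro z hz
  have hD := (det_transit_ne hz).isUnit
  have hE := mul_eq_one_comm.1 (conjTranspose_mul_schur _ (det_transit_ne hz))
  rw [extChartAt_apply, Equiv.apply_symm_apply]
  change (toChart x z).comp ((mulLR 1 (frameMatrix x z * T * (frameMatrix x z)⁻¹)).comp
    (fromChart x z)) = _
  -- In the chart the field is right multiplication by D (D⁻¹G) T (D⁻¹G)⁻¹ D⁻¹ = G T G⁻¹: the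
  -- possibly discontinuous D drops out.
  rw [toChart, fromChart, mulLR_comp, mulLR_comp, Matrix.one_mul, hE, frameMatrix,
    Matrix.mul_inv_rev, nonsing_inv_nonsing_inv _ hD]
  congr 1
  simp only [Matrix.mul_assoc]
  rw [mul_nonsing_inv_cancel_left _ _ hD, mul_nonsing_inv _ hD, Matrix.mul_one]

theorem frameField_mul {n : ℕ} {x y : SymSpace n} (S T : Matrix (Fin 2) (Fin 2) ℂ)
    (hy : y ∈ (chartAt (Mod n) x).source) :
    frameField x S y * frameField x T y = frameField x (T * S) y := by
  have hW := isUnit_det_frameMatrix hy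
  refine (mulLR_mul _ _ _ _).trans ?_
  rw [frameField, rightMul_apply, Matrix.one_mul]
  congr 1
  simp only [Matrix.mul_assoc]
  rw [nonsing_inv_mul_cancel_left _ _ hW]

theorem frameField_neg {n : ℕ} (x y : SymSpace n) (T : Matrix (Fin 2) (Fin 2) ℂ) :
    frameField x (-T) y = -frameField x T y := by
  rw [frameField, Matrix.mul_neg, Matrix.neg_mul, map_neg]; rfl

theorem frameField_one {n : ℕ} {x y : SymSpace n} (hy : y ∈ (chartAt (Mod n) x).source) :
    frameField x 1 y = 1 := by
  rw [frameField, Matrix.mul_one, mul_nonsing_inv _ (isUnit_det_frameMatrix hy)]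
  exact mulLR_one

/-- Conjugation by the frame matrix maps su(2) onto itself, so the conjugated units still span the
fibre. -/
theorem span_frameField {n : ℕ} {x y : SymSpace n} (hy : y ∈ (chartAt (Mod n) x).source) :
    quaternionicStructure n y =
      Submodule.span ℝ {frameField x unitJ y, frameField x unitI y, frameField x unitK y} := by
  have hW := isUnit_det_frameMatrix hy
  let f : Matrix (Fin 2) (Fin 2) ℂ →ₗ[ℝ] (Mod n →L[ℝ] Mod n) :=
    (rightMul n).comp ((LinearMap.mulRight ℝ (frameMatrix x y)⁻¹).comp
      (LinearMap.mulLeft ℝ (frameMatrix x y)))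
  have h1 : su2.map f = su2.map (rightMul n) := by
    apply le_antisymm
    · rintro _ ⟨T, hT, rfl⟩
      exact ⟨_, (conj_frameMatrix_mem hy hT).1, rfl⟩
    · rintro _ ⟨T, hT, rfl⟩
      refine ⟨_, (conj_frameMatrix_mem hy hT).2, ?_⟩
      change rightMul n (frameMatrix x y * ((frameMatrix x y)⁻¹ * T * frameMatrix x y) *
        (frameMatrix x y)⁻¹) = _
      rw [Matrix.mul_assoc _ T, mul_nonsing_inv_cancel_left _ _ hW,
        mul_nonsing_inv_cancel_right _ _ hW]
  have h2 : su2.map f = Submodule.span ℝ {f unitJ, f unitI, f unitK} := by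
    rw [su2_eq_span, Submodule.map_span, Set.insert_comm]
    simp only [Set.image_insert_eq, Set.image_singleton]
  rw [quaternionicStructure_eq]
  exact h1.symm.trans h2

theorem isAlmostQuaternionic (n : ℕ) : IsAlmostQuaternionic (quaternionicStructure n) := by
  intro x
  -- Right multiplications compose in reverse order, so the roles of `unitI` and `unitJ` are
  -- exchanged to obtain I J = K.
  refine ⟨(chartAt (Mod n) x).source, (chartAt (Mod n) x).open_source, mem_chart_source _ x,
    frameField x unitJ, frameField x unitI, frameField x unitK, fun y hy ↦ ⟨⟨?_, ?_, ?_⟩,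
      ⟨?_, ?_, ?_⟩, ⟨?_, ?_⟩, span_frameField hy⟩⟩
  · exact frameField_smoothAt _ hy
  · exact frameField_smoothAt _ hy
  · exact frameField_smoothAt _ hy
  · rw [frameField_mul _ _ hy, unitJ_sq, frameField_neg, frameField_one hy]
  · rw [frameField_mul _ _ hy, unitI_sq, frameField_neg, frameField_one hy]
  · rw [frameField_mul _ _ hy, unitK_sq, frameField_neg, frameField_one hy]
  · rw [frameField_mul _ _ hy, unitI_mul_unitJ]
  · rw [frameField_mul _ _ hy, unitJ_mul_unitI, frameField_neg]

end Frames
-- The standard invariant Hermitian structure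
section StandardMetric
open Matrix

/-- The bilinear form `Re tr (N v* M w)`. -/
noncomputable def traceForm {n : ℕ} (M : Matrix (Fin n) (Fin n) ℂ)
    (N : Matrix (Fin 2) (Fin 2) ℂ) : Mod n →L[ℝ] Mod n →L[ℝ] ℝ :=
  LinearMap.toContinuousLinearMap
    ((LinearMap.toContinuousLinearMap : (Mod n →ₗ[ℝ] ℝ) ≃ₗ[ℝ] (Mod n →L[ℝ] ℝ)).toLinearMap.comp
      (LinearMap.mk₂ ℝ (fun v w : Mod n ↦ ((N * (of v)ᴴ * M * of w).trace).re)
        (fun v v' w ↦ by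
          have h : of (v + v') = of v + of v' := rfl
          rw [h, conjTranspose_add, Matrix.mul_add, Matrix.add_mul, Matrix.add_mul, trace_add,
            Complex.add_re])
        (fun c v w ↦ by
          have h : of (c • v) = c • of v := rfl
          rw [h, conjTranspose_smul, star_trivial, Matrix.mul_smul, Matrix.smul_mul,
            Matrix.smul_mul, trace_smul, Complex.smul_re])
        (fun v w w' ↦ by
          have h : of (w + w') = of w + of w' := rfl
          rw [h, Matrix.mul_add, trace_add, Complex.add_re])
        (fun c v w ↦ by
          have h : of (c • w) = c • of w := rfl
          rw [h, Matrix.mul_smul, trace_smul, Complex.smul_re])))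

theorem traceForm_apply {n : ℕ} (M : Matrix (Fin n) (Fin n) ℂ) (N : Matrix (Fin 2) (Fin 2) ℂ)
    (v w : Mod n) : traceForm M N v w = ((N * (of v)ᴴ * M * of w).trace).re := rfl

/-- By cyclicity of the trace this family of forms is stable under v ↦ E v T. The rule serves both
for invariance, where E and T are unitary, and for the expression in a chart. -/
theorem traceForm_mulLR {n : ℕ} (M E : Matrix (Fin n) (Fin n) ℂ) (N T : Matrix (Fin 2) (Fin 2) ℂ)
    (v w : Mod n) : traceForm M N (mulLR E T v) (mulLR E T w) =
      traceForm (Eᴴ * M * E) (T * N * Tᴴ) v w := by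
  rw [traceForm_apply, traceForm_apply, mulLR_apply, mulLR_apply, Equiv.apply_symm_apply,
    Equiv.apply_symm_apply, conjTranspose_mul, conjTranspose_mul]
  have h : N * (Tᴴ * ((of v)ᴴ * Eᴴ)) * M * (E * of w * T) =
      (N * Tᴴ * (of v)ᴴ * (Eᴴ * M * E) * of w) * T := by simp only [Matrix.mul_assoc]
  rw [h, trace_mul_comm]
  simp only [Matrix.mul_assoc]

theorem traceForm_symm {n : ℕ} (v w : Mod n) : traceForm 1 1 v w = traceForm 1 1 w v := by
  rw [traceForm_apply, traceForm_apply, Matrix.one_mul, Matrix.mul_one, Matrix.one_mul,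
    Matrix.mul_one, ← Complex.conj_re, ← Complex.star_def, ← trace_conjTranspose,
    conjTranspose_mul, conjTranspose_conjTranspose]

theorem traceForm_self {n : ℕ} (v : Mod n) :
    traceForm 1 1 v v = ∑ j, ∑ i, Complex.normSq (v i j) := by
  rw [traceForm_apply, Matrix.one_mul, Matrix.mul_one, Matrix.trace, Complex.re_sum]
  refine Finset.sum_congr rfl fun j _ ↦ ?_
  rw [diag_apply, Matrix.mul_apply, Complex.re_sum]
  refine Finset.sum_congr rfl fun i _ ↦ ?_
  rw [conjTranspose_apply, Complex.star_def, mul_comm, of_apply, Complex.mul_conj,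
    Complex.ofReal_re]

theorem normSq_le_traceForm {n : ℕ} (v : Mod n) (i : Fin n) (j : Fin 2) :
    Complex.normSq (v i j) ≤ traceForm 1 1 v v := by
  rw [traceForm_self]
  have h1 : Complex.normSq (v i j) ≤ ∑ i, Complex.normSq (v i j) :=
    Finset.single_le_sum (f := fun i ↦ Complex.normSq (v i j))
      (fun _ _ ↦ Complex.normSq_nonneg _) (Finset.mem_univ i)
  refine h1.trans ?_
  exact Finset.single_le_sum (f := fun j ↦ ∑ i, Complex.normSq (v i j))
      (fun _ _ ↦ Finset.sum_nonneg fun _ _ ↦ Complex.normSq_nonneg _) (Finset.mem_univ j)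

theorem traceForm_pos {n : ℕ} {v : Mod n} (hv : v ≠ 0) : 0 < traceForm 1 1 v v := by
  by_contra h
  apply hv
  funext i j
  have h1 := normSq_le_traceForm v i j
  have h2 := Complex.normSq_nonneg (v i j)
  exact Complex.normSq_eq_zero.1 (by linarith)

/-- The form dominates every |vᵢⱼ|², so its unit ball lies in that of the sup norm. -/
theorem isVonNBounded_traceForm {n : ℕ} :
    Bornology.IsVonNBounded ℝ {v : Mod n | traceForm 1 1 v v < 1} := by
  refine (NormedSpace.isVonNBounded_closedBall ℝ (Mod n) 1).subset fun v hv ↦ ?_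
  rw [mem_closedBall_zero_iff, pi_norm_le_iff_of_nonneg zero_le_one]
  intro i
  rw [pi_norm_le_iff_of_nonneg zero_le_one]
  intro j
  have h1 := (normSq_le_traceForm v i j).trans (le_of_lt hv)
  rw [Complex.normSq_eq_norm_sq] at h1
  nlinarith [norm_nonneg (v i j)]

theorem contDiff_traceForm {n : ℕ} {M : Mod n → Matrix (Fin n) (Fin n) ℂ}
    {N : Mod n → Matrix (Fin 2) (Fin 2) ℂ} (hM : EntrySmooth Set.univ M)
    (hN : EntrySmooth Set.univ N) : ContDiff ℝ ∞ fun X ↦ traceForm (M X) (N X) := by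
  rw [contDiff_clm_apply_iff]
  intro v
  rw [contDiff_clm_apply_iff]
  intro w
  simp only [traceForm_apply, Matrix.trace, Complex.re_sum]
  refine ContDiff.sum fun j _ ↦ Complex.reCLM.contDiff.comp ?_
  exact contDiffOn_univ.1 ((((hN.mul (EntrySmooth.const (of v)ᴴ)).mul hM).mul
    (EntrySmooth.const (of w))) j j)

/-- The Hermitian form of the standard metric in the chart, as a function of the coordinates. -/
noncomputable def coGram {n : ℕ} (X : Matrix (Fin n) (Fin 2) ℂ) : Matrix (Fin n) (Fin n) ℂ :=
  1 - X * gramInv X * Xᴴ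

theorem entrySmooth_coGram {n : ℕ} : EntrySmooth Set.univ fun X : Mod n ↦ coGram (of X) :=
  fun i j ↦ contDiffOn_const.sub
    (((entrySmooth_id (n := n)).mul entrySmooth_gramInv).mul (entrySmooth_id (n := n)).conj i j)

theorem traceForm_fromChart {n : ℕ} {x y : SymSpace n} (hy : y ∈ (chartAt (Mod n) x).source)
    (v w : Mod n) : traceForm 1 1 (fromChart x y v) (fromChart x y w) =
      traceForm (coGram (graphCoord x.out y)) (gramInv (graphCoord x.out y)) v w := by
  obtain ⟨h1, h2⟩ := transit_gram hy
  rw [fromChart, traceForm_mulLR, conjTranspose_conjTranspose, Matrix.mul_one, Matrix.mul_one, h1,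
    h2, coGram]

/-- The inner products `Re tr (v* w)` on the tangent spaces. -/
noncomputable def standardInner (n : ℕ) (x : SymSpace n) :
    TangentSpace 𝓘(ℝ, Mod n) x →L[ℝ] TangentSpace 𝓘(ℝ, Mod n) x →L[ℝ] ℝ :=
  (traceForm 1 1 : Mod n →L[ℝ] Mod n →L[ℝ] ℝ)

/-- In a fixed chart the metric is given by the smooth matrices (1 + X*X)⁻¹ and 1 − X (1 + X*X)⁻¹
X*; only the products D D* and A A* of the transition blocks enter. -/
theorem contMDiff_standardMetric (n : ℕ) :
    ContMDiff 𝓘(ℝ, Mod n) (𝓘(ℝ, Mod n).prod 𝓘(ℝ, Mod n →L[ℝ] Mod n →L[ℝ] ℝ)) ∞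
      (fun x : SymSpace n ↦ TotalSpace.mk' (Mod n →L[ℝ] Mod n →L[ℝ] ℝ)
        (E := fun y : SymSpace n ↦ TangentSpace 𝓘(ℝ, Mod n) y →L[ℝ]
          TangentSpace 𝓘(ℝ, Mod n) y →L[ℝ] ℝ) x (standardInner n x)) := by
  intro x
  refine (contMDiffAt_section x).2 ?_
  have h2 : ContMDiffAt 𝓘(ℝ, Mod n) 𝓘(ℝ, Mod n →L[ℝ] Mod n →L[ℝ] ℝ) ∞
      (fun z : SymSpace n ↦ (fun X : Mod n ↦ traceForm (coGram (of X)) (gramInv (of X)))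
        (extChartAt 𝓘(ℝ, Mod n) x z)) x :=
    (contDiff_traceForm entrySmooth_coGram entrySmooth_gramInv).contMDiff.contMDiffAt.comp x
      (contMDiffAt_extChartAt' (mem_chart_source _ x))
  refine h2.congr_of_eventuallyEq ?_
  filter_upwards [(chartAt (Mod n) x).open_source.mem_nhds (mem_chart_source _ x)] with z hz
  rw [hom_trivializationAt_apply]
  refine ContinuousLinearMap.ext fun v ↦ ContinuousLinearMap.ext fun w ↦ ?_
  have hb : z ∈ (trivializationAt (Mod n) (TangentSpace 𝓘(ℝ, Mod n)) x).baseSet := by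
    simpa using hz
  rw [inCoordinates_apply_eq₂ hb hb (Set.mem_univ _), extChartAt_apply, Equiv.apply_symm_apply,
    ← traceForm_fromChart hz]
  have hs : ∀ u : Mod n, (trivializationAt (Mod n) (TangentSpace 𝓘(ℝ, Mod n)) x).symm z u =
      fromChart x z u := fun u ↦
    (Trivialization.symmL_apply (R := ℝ) _ hb u).symm.trans
      (congrArg (fun f : Mod n →L[ℝ] Mod n ↦ f u) (symmL_eq hz))
  rw [hs, hs]
  simp
  rfl

/-- The invariant Riemannian metric `Re tr (v* w)`. -/
noncomputable def standardMetric (n : ℕ) :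
    ContMDiffRiemannianMetric 𝓘(ℝ, Mod n) ∞ (Mod n)
      (fun x : SymSpace n ↦ TangentSpace 𝓘(ℝ, Mod n) x) where
  inner := standardInner n
  symm _ v w := traceForm_symm v w
  pos _ _ hv := traceForm_pos hv
  isVonNBounded _ := isVonNBounded_traceForm
  contMDiff := contMDiff_standardMetric n

/-- Multiplication by the imaginary unit. -/
noncomputable def mulI (n : ℕ) : Mod n →L[ℝ] Mod n := mulLR (Complex.I • 1) 1

/-- All chart transitions and the action have complex linear differentials; this yields invariance,
smoothness and integrability of multiplication by i. -/
theorem mulI_mul_mulLR {n : ℕ} (E : Matrix (Fin n) (Fin n) ℂ) (T : Matrix (Fin 2) (Fin 2) ℂ) :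
    mulI n * mulLR E T = mulLR E T * mulI n := by
  rw [mulI, mulLR_mul, mulLR_mul, Matrix.one_mul, Matrix.mul_one, Matrix.smul_mul, Matrix.mul_smul,
    Matrix.one_mul, Matrix.mul_one]

theorem mulI_mulLR_apply {n : ℕ} (E : Matrix (Fin n) (Fin n) ℂ) (T : Matrix (Fin 2) (Fin 2) ℂ)
    (v : Mod n) : mulI n (mulLR E T v) = mulLR E T (mulI n v) :=
  congrArg (fun f : Mod n →L[ℝ] Mod n ↦ f v) (mulI_mul_mulLR E T)

theorem mulI_sq (n : ℕ) : mulI n * mulI n = -1 := by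
  rw [mulI, mulLR_mul, Matrix.one_mul, Matrix.smul_mul, Matrix.one_mul, smul_smul, Complex.I_mul_I]
  ext1 v
  change (-1 : ℂ) • (1 : Matrix (Fin n) (Fin n) ℂ) * of v * (1 : Matrix (Fin 2) (Fin 2) ℂ) = -of v
  simp

theorem traceForm_mulI {n : ℕ} (v w : Mod n) :
    traceForm 1 1 (mulI n v) (mulI n w) = traceForm 1 1 v w := by
  rw [mulI, traceForm_mulLR]
  simp [smul_smul]

/-- The standard invariant Hermitian structure. -/
noncomputable def standardHermitian (n : ℕ) : AlmostHermitian (Mod n) (SymSpace n) where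
  g := standardMetric n
  J _ := mulI n
  smooth x := by
    refine EndField.smoothAt_of_chart (x := x) (F := fun _ ↦ mulI n) contDiff_const ?_
      (mem_chart_source _ x)
    intro y hy
    have h : toChart x y * (mulI n * fromChart x y) = mulI n := by
      rw [fromChart, mulI_mul_mulLR, ← mul_assoc, ← fromChart, toChart_mul_fromChart hy, one_mul]
    exact h
  sq _ := mulI_sq n
  hermitian _ v w := traceForm_mulI v w

theorem standardHermitian_isInvariant (n : ℕ) : (standardHermitian n).IsInvariant (SU n) where
  metric a x v w := by
    obtain ⟨h1, h2⟩ := blockDiag_unitary (inv_mul_mul_mem a x)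
    rw [mfderiv_action]
    refine (traceForm_mulLR _ _ _ _ _ _).trans ?_
    rw [Matrix.mul_one, Matrix.mul_one, h2, conjTranspose_conjTranspose,
      mul_eq_one_comm.1 h1]
    rfl
  complex a x v := by
    rw [mfderiv_action]
    exact mulI_mulLR_apply _ _ v

end StandardMetric
-- Closedness and integrability of the standard structure
section Kahler
open Matrix

/-- Entrywise differentiability of a matrix valued curve. -/
def EntryDeriv {a b : Type*} (F : ℝ → Matrix a b ℂ) (F' : Matrix a b ℂ) (t : ℝ) : Prop :=
  ∀ i j, HasDerivAt (fun s ↦ F s i j) (F' i j) t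

theorem EntryDeriv.const {a b : Type*} (A : Matrix a b ℂ) (t : ℝ) :
    EntryDeriv (fun _ ↦ A) 0 t := fun _ _ ↦ hasDerivAt_const _ _

theorem EntryDeriv.mul {a b c : Type*} [Fintype b] {F : ℝ → Matrix a b ℂ} {G : ℝ → Matrix b c ℂ}
    {F' : Matrix a b ℂ} {G' : Matrix b c ℂ} {t : ℝ} (hF : EntryDeriv F F' t)
    (hG : EntryDeriv G G' t) : EntryDeriv (fun s ↦ F s * G s) (F' * G t + F t * G') t := by
  intro i j
  simp only [Matrix.add_apply, Matrix.mul_apply, ← Finset.sum_add_distrib]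
  exact HasDerivAt.fun_sum fun k _ ↦ (hF i k).mul (hG k j)

theorem EntryDeriv.conj {a b : Type*} {F : ℝ → Matrix a b ℂ} {F' : Matrix a b ℂ} {t : ℝ}
    (hF : EntryDeriv F F' t) : EntryDeriv (fun s ↦ (F s)ᴴ) F'ᴴ t := fun i j ↦
  Complex.conjCLE.toContinuousLinearMap.hasFDerivAt.comp_hasDerivAt t (hF j i)

theorem EntryDeriv.const_add {a b : Type*} (A : Matrix a b ℂ) {F : ℝ → Matrix a b ℂ}
    {F' : Matrix a b ℂ} {t : ℝ} (hF : EntryDeriv F F' t) :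
    EntryDeriv (fun s ↦ A + F s) F' t := fun i j ↦ (hF i j).const_add (A i j)

theorem EntryDeriv.unique {a b : Type*} {F : ℝ → Matrix a b ℂ}
    {F' F'' : Matrix a b ℂ} {t : ℝ} (hF : EntryDeriv F F' t) (hF' : EntryDeriv F F'' t) :
    F' = F'' := by
  ext i j
  exact (hF i j).unique (hF' i j)

theorem EntryDeriv.trace {a : Type*} [Fintype a] {F : ℝ → Matrix a a ℂ}
    {F' : Matrix a a ℂ} {t : ℝ} (hF : EntryDeriv F F' t) :
    HasDerivAt (fun s ↦ (F s).trace) F'.trace t :=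
  HasDerivAt.fun_sum fun k _ ↦ hF k k

theorem hasDerivAt_line {n : ℕ} (X v : Mod n) :
    HasDerivAt (fun t : ℝ ↦ X + t • v) v 0 := by
  simpa using ((hasDerivAt_id (0 : ℝ)).smul_const v).const_add X

theorem entryDeriv_line {n : ℕ} (X v : Mod n) :
    EntryDeriv (fun t : ℝ ↦ of (X + t • v)) (of v) 0 := fun i j ↦
  hasDerivAt_pi.1 (hasDerivAt_pi.1 (hasDerivAt_line X v) i) j

theorem gramInv_mul {n : ℕ} (X : Matrix (Fin n) (Fin 2) ℂ) : gramInv X * (1 + Xᴴ * X) = 1 :=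
  nonsing_inv_mul _ (det_gram_ne X).isUnit

theorem mul_gramInv {n : ℕ} (X : Matrix (Fin n) (Fin 2) ℂ) : (1 + Xᴴ * X) * gramInv X = 1 :=
  mul_nonsing_inv _ (det_gram_ne X).isUnit

theorem gramInv_conj {n : ℕ} (X : Matrix (Fin n) (Fin 2) ℂ) : (gramInv X)ᴴ = gramInv X := by
  rw [gramInv, conjTranspose_nonsing_inv, (posDef_gram X).1.eq]

theorem coGram_conj {n : ℕ} (X : Matrix (Fin n) (Fin 2) ℂ) : (coGram X)ᴴ = coGram X := by
  simp only [coGram, conjTranspose_sub, conjTranspose_one, conjTranspose_mul,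
    conjTranspose_conjTranspose, gramInv_conj, Matrix.mul_assoc]

/-- Differentiability is known from smoothness, so the value is found by differentiating N (1 + X*X)
= 1 and solving for N'. -/
theorem entryDeriv_gramInv {n : ℕ} (X v : Mod n) :
    EntryDeriv (fun t : ℝ ↦ gramInv (of (X + t • v)))
      (-(gramInv (of X) * ((of v)ᴴ * of X + (of X)ᴴ * of v) * gramInv (of X))) 0 := by
  have hX0 : X + (0 : ℝ) • v = X := by simp
  obtain ⟨N', hN'⟩ : ∃ N', EntryDeriv (fun t : ℝ ↦ gramInv (of (X + t • v))) N' 0 := by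
    have h : ∀ i j, ∃ d, HasDerivAt (fun t : ℝ ↦ gramInv (of (X + t • v)) i j) d 0 := by
      intro i j
      have h1 : DifferentiableAt ℝ (fun Y : Mod n ↦ gramInv (of Y) i j) (X + (0 : ℝ) • v) :=
        ((contDiffOn_univ.1 (entrySmooth_gramInv (n := n) i j)).differentiable (by simp)) _
      have h2 := h1.hasFDerivAt.comp_hasDerivAt 0 (hasDerivAt_line X v)
      exact ⟨_, h2⟩
    choose d hd using h
    exact ⟨of d, hd⟩
  have hline := entryDeriv_line X v
  have hP := (hline.conj.mul hline).const_add 1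
  have hprod := hN'.mul hP
  have hone : EntryDeriv (fun t : ℝ ↦ gramInv (of (X + t • v)) *
      (1 + (of (X + t • v))ᴴ * of (X + t • v))) 0 0 := by
    simp only [gramInv_mul]
    exact EntryDeriv.const _ _
  have h := hprod.unique hone
  rw [hX0] at h
  have h3 : N' = -(gramInv (of X) * ((of v)ᴴ * of X + (of X)ᴴ * of v) * gramInv (of X)) := by
    have h4 := congrArg (· * gramInv (of X)) h
    simp only [Matrix.zero_mul] at h4
    rw [Matrix.add_mul, Matrix.mul_assoc N', mul_gramInv, Matrix.mul_one] at h4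
    exact eq_neg_of_add_eq_zero_left h4
  rw [← h3]
  exact hN'

/-- The linear form `Im tr (K w)`. -/
noncomputable def imTrace {n : ℕ} (K : Matrix (Fin 2) (Fin n) ℂ) : Mod n →L[ℝ] ℝ :=
  LinearMap.toContinuousLinearMap
    { toFun := fun w ↦ ((K * of w).trace).im
      map_add' := fun v w ↦ by
        have h : of (v + w) = of v + of w := rfl
        rw [h, Matrix.mul_add, trace_add, Complex.add_im]
      map_smul' := fun c w ↦ by
        have h : of (c • w) = c • of w := rfl
        rw [h, Matrix.mul_smul, trace_smul, Complex.smul_im]; rfl }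

theorem imTrace_apply {n : ℕ} (K : Matrix (Fin 2) (Fin n) ℂ) (w : Mod n) :
    imTrace K w = ((K * of w).trace).im := rfl

theorem contDiff_imTrace {n : ℕ} :
    ContDiff ℝ ∞ fun X : Mod n ↦ imTrace (gramInv (of X) * (of X)ᴴ) := by
  rw [contDiff_clm_apply_iff]
  intro w
  simp only [imTrace_apply, Matrix.trace, Complex.im_sum]
  refine ContDiff.sum fun j _ ↦ Complex.imCLM.contDiff.comp ?_
  exact contDiffOn_univ.1 (((entrySmooth_gramInv.mul (entrySmooth_id (n := n)).conj).mul
    (EntrySmooth.const (of w))) j j)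

/-- The term −N v*X N X*w from N' combines with N v*w into the first summand. The second is
symmetric in v and w by cyclicity, hence disappears from the exterior derivative. -/
theorem fderiv_imTrace {n : ℕ} (X v w : Mod n) :
    fderiv ℝ (fun Y : Mod n ↦ imTrace (gramInv (of Y) * (of Y)ᴴ) w) X v =
      ((gramInv (of X) * (of v)ᴴ * coGram (of X) * of w).trace).im -
      ((gramInv (of X) * (of X)ᴴ * of v * (gramInv (of X) * (of X)ᴴ * of w)).trace).im := by
  have hX0 : X + (0 : ℝ) • v = X := by simp
  have hd : DifferentiableAt ℝ (fun Y : Mod n ↦ imTrace (gramInv (of Y) * (of Y)ᴴ) w)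
      (X + (0 : ℝ) • v) :=
    (((contDiff_clm_apply_iff.1 contDiff_imTrace) w).differentiable (by simp)) _
  have h1 := hd.hasFDerivAt.comp_hasDerivAt 0 (hasDerivAt_line X v)
  have h2 := Complex.imCLM.hasFDerivAt.comp_hasDerivAt 0
    (((entryDeriv_gramInv X v).mul (entryDeriv_line X v).conj).mul
      (EntryDeriv.const (of w) 0)).trace
  rw [hX0] at h1 h2
  refine (h1.unique h2).trans ?_
  rw [Complex.imCLM_apply, ← Complex.sub_im, ← trace_sub]
  congr 2
  rw [Matrix.mul_zero, add_zero, coGram]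
  simp only [Matrix.mul_add, Matrix.add_mul, Matrix.mul_sub, Matrix.sub_mul, Matrix.neg_mul,
    Matrix.mul_one, Matrix.mul_assoc]
  abel

theorem traceForm_mulI_right {n : ℕ} (M : Matrix (Fin n) (Fin n) ℂ) (N : Matrix (Fin 2) (Fin 2) ℂ)
    (v w : Mod n) : -traceForm M N v (mulI n w) = ((N * (of v)ᴴ * M * of w).trace).im := by
  have h : of (mulI n w) = Complex.I • of w := by
    change (Complex.I • (1 : Matrix (Fin n) (Fin n) ℂ)) * of w * (1 : Matrix (Fin 2) (Fin 2) ℂ) = _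
    rw [Matrix.smul_mul, Matrix.one_mul, Matrix.mul_one]
  rw [traceForm_apply, h, Matrix.mul_smul, trace_smul]
  simp

/-- For Hermitian M and N the form tr(N v* M w) is Hermitian, so its imaginary part is skew. -/
theorem im_trace_swap {n : ℕ} {M : Matrix (Fin n) (Fin n) ℂ} {N : Matrix (Fin 2) (Fin 2) ℂ}
    (hM : Mᴴ = M) (hN : Nᴴ = N) (v w : Matrix (Fin n) (Fin 2) ℂ) :
    ((N * wᴴ * M * v).trace).im = -((N * vᴴ * M * w).trace).im := by
  have h : (N * wᴴ * M * v)ᴴ = vᴴ * M * w * N := by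
    simp only [conjTranspose_mul, conjTranspose_conjTranspose, hM, hN, Matrix.mul_assoc]
  have h2 : (N * vᴴ * M * w).trace = star ((N * wᴴ * M * v).trace) := by
    rw [← trace_conjTranspose, h, trace_mul_comm (vᴴ * M * w)]
    simp only [Matrix.mul_assoc]
  rw [h2, Complex.star_def, Complex.conj_im, neg_neg]

/-- A primitive of the standard fundamental form in a chart. -/
noncomputable def primitiveForm (n : ℕ) (X : Mod n) : Mod n [⋀^Fin 1]→L[ℝ] ℝ :=
  ContinuousAlternatingMap.ofSubsingletonLIE (𝕜 := ℝ) (0 : Fin 1)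
    ((1 / 2 : ℝ) • imTrace (gramInv (of X) * (of X)ᴴ))

theorem contDiff_primitiveForm (n : ℕ) : ContDiff ℝ ∞ (primitiveForm n) :=
  (ContinuousAlternatingMap.ofSubsingletonLIE (𝕜 := ℝ) (E := Mod n) (F := ℝ)
    (0 : Fin 1)).contDiff.comp (contDiff_imTrace.const_smul (1 / 2 : ℝ))

theorem extDeriv_primitiveForm {n : ℕ} (X v w : Mod n) :
    extDeriv (primitiveForm n) X ![v, w] =
      ((gramInv (of X) * (of v)ᴴ * coGram (of X) * of w).trace).im := by
  rw [extDeriv_apply ((contDiff_primitiveForm n).differentiable (by simp) X)]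
  have h : ∀ (u : Fin 1 → Mod n) (z : Mod n),
      fderiv ℝ (fun Y ↦ primitiveForm n Y u) X z =
        (1 / 2 : ℝ) * fderiv ℝ (fun Y : Mod n ↦ imTrace (gramInv (of Y) * (of Y)ᴴ) (u 0)) X z := by
    intro u z
    have hd : DifferentiableAt ℝ (fun Y : Mod n ↦ imTrace (gramInv (of Y) * (of Y)ᴴ) (u 0)) X :=
      (((contDiff_clm_apply_iff.1 contDiff_imTrace) (u 0)).differentiable (by simp)) _
    change fderiv ℝ (fun Y ↦ (1 / 2 : ℝ) * imTrace (gramInv (of Y) * (of Y)ᴴ) (u 0)) X z = _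
    rw [fderiv_const_mul hd]
    rfl
  rw [Fin.sum_univ_two, h, h]
  have e0 : (Fin.removeNth 0 ![v, w] : Fin 1 → Mod n) 0 = w := rfl
  have e1 : (Fin.removeNth 1 ![v, w] : Fin 1 → Mod n) 0 = v := rfl
  rw [e0, e1]
  change (-1 : ℤ) ^ 0 • (1 / 2 * fderiv ℝ _ X v) + (-1 : ℤ) ^ 1 • (1 / 2 * fderiv ℝ _ X w) = _
  -- The skew parts of the two terms add up, which the factor 1/2 in the primitive compensates.
  rw [fderiv_imTrace, fderiv_imTrace,
    im_trace_swap (coGram_conj (of X)) (gramInv_conj (of X)) (of v) (of w),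
    trace_mul_comm (gramInv (of X) * (of X)ᴴ * of w)]
  simp only [pow_zero, pow_one, one_smul, neg_smul]
  ring

theorem extChartAt_symm_mem {n : ℕ} (x : SymSpace n) (X : Mod n) :
    (extChartAt 𝓘(ℝ, Mod n) x).symm X ∈ (chartAt (Mod n) x).source :=
  (graphChart x.out).map_target (Set.mem_univ X)

/-- Each graph chart has the whole matrix space as target, so the fundamental form is exact on the
entire chart and closedness is d² = 0. -/
theorem standardHermitian_inChart {n : ℕ} (x : SymSpace n) :
    (standardHermitian n).fundamentalForm.inChart x = extDeriv (primitiveForm n) := by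
  funext X
  set y := (extChartAt 𝓘(ℝ, Mod n) x).symm X with hy
  have hX : X ∈ (extChartAt 𝓘(ℝ, Mod n) x).target := by
    rw [extChartAt_target_eq]; trivial
  have hys : y ∈ (chartAt (Mod n) x).source := extChartAt_symm_mem x X
  have hXy : X = extChartAt 𝓘(ℝ, Mod n) x y := ((extChartAt 𝓘(ℝ, Mod n) x).right_inv hX).symm
  have hm := mfderiv_chart_symm hys
  rw [← hXy] at hm
  have hc : graphCoord x.out y = of X := by rw [hXy]; rfl
  ext u
  have hu : u = ![u 0, u 1] := by
    funext i; fin_cases i <;> rfl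
  rw [hu, extDeriv_primitiveForm]
  rw [TwoForm.inChart, hm]
  change -traceForm 1 1 (fromChart x y (u 0)) (mulI n (fromChart x y (u 1))) = _
  rw [fromChart, mulI_mulLR_apply, ← fromChart, traceForm_fromChart hys, hc, traceForm_mulI_right]

/-- The bracket is computed in the chart centred at `x`: fields are pulled back by the inverse of
`fromChart`, which is `toChart`, and the chart has identity differential at its centre. -/
theorem mlieBracket_eq {n : ℕ} (V W : (x : SymSpace n) → TangentSpace 𝓘(ℝ, Mod n) x)
    (x : SymSpace n) : VectorField.mlieBracket 𝓘(ℝ, Mod n) V W x =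
      VectorField.lieBracket ℝ
        (fun X : Mod n ↦ toChart x ((extChartAt 𝓘(ℝ, Mod n) x).symm X)
          (V ((extChartAt 𝓘(ℝ, Mod n) x).symm X)))
        (fun X : Mod n ↦ toChart x ((extChartAt 𝓘(ℝ, Mod n) x).symm X)
          (W ((extChartAt 𝓘(ℝ, Mod n) x).symm X))) 0 := by
  have hpull : ∀ V : (x : SymSpace n) → TangentSpace 𝓘(ℝ, Mod n) x,
      VectorField.mpullbackWithin 𝓘(ℝ, Mod n) 𝓘(ℝ, Mod n) (extChartAt 𝓘(ℝ, Mod n) x).symm V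
        (Set.range 𝓘(ℝ, Mod n)) = (fun X : Mod n ↦ toChart x ((extChartAt 𝓘(ℝ, Mod n) x).symm X)
          (V ((extChartAt 𝓘(ℝ, Mod n) x).symm X))) := by
    intro V
    funext X
    have hX : X ∈ (extChartAt 𝓘(ℝ, Mod n) x).target := by
      rw [extChartAt_target_eq]; trivial
    have hys := extChartAt_symm_mem x X
    have hm := mfderiv_chart_symm hys
    rw [(extChartAt 𝓘(ℝ, Mod n) x).right_inv hX] at hm
    rw [VectorField.mpullbackWithin_apply, ModelWithCorners.range_eq_univ, mfderivWithin_univ, hm]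
    have hinv : (fromChart x ((extChartAt 𝓘(ℝ, Mod n) x).symm X)).inverse =
        toChart x ((extChartAt 𝓘(ℝ, Mod n) x).symm X) :=
      ContinuousLinearMap.inverse_eq (fromChart_mul_toChart hys) (toChart_mul_fromChart hys)
    exact congrArg (fun f : Mod n →L[ℝ] Mod n ↦ f (V ((extChartAt 𝓘(ℝ, Mod n) x).symm X))) hinv
  rw [← VectorField.mlieBracketWithin_univ, VectorField.mlieBracketWithin_apply, hpull, hpull,
    mfderiv_extChartAt_self, extChartAt_self, ModelWithCorners.range_eq_univ, Set.preimage_univ,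
    Set.univ_inter, VectorField.lieBracketWithin_univ]
  exact congrArg (fun f : Mod n →L[ℝ] Mod n ↦ f _) ContinuousLinearMap.inverse_id

/-- Multiplication by the imaginary unit, as an equivalence. -/
noncomputable def mulIEquiv (n : ℕ) : Mod n ≃L[ℝ] Mod n :=
  ContinuousLinearEquiv.equivOfInverse (mulI n) (-mulI n)
    (fun v ↦ by
      have h := congrArg (fun f : Mod n →L[ℝ] Mod n ↦ f v) (mulI_sq n)
      change -(mulI n (mulI n v)) = v
      rw [show mulI n (mulI n v) = -v from h, neg_neg])
    (fun v ↦ by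
      have h := congrArg (fun f : Mod n →L[ℝ] Mod n ↦ f v) (mulI_sq n)
      change mulI n (-(mulI n v)) = v
      rw [map_neg, show mulI n (mulI n v) = -v from h, neg_neg])

theorem fderiv_mulI_comp {n : ℕ} (V : Mod n → Mod n) (X v : Mod n) :
    fderiv ℝ (fun Y ↦ mulI n (V Y)) X v = mulI n (fderiv ℝ V X v) := by
  -- Composition with a linear equivalence commutes with `fderiv` even where V is not
  -- differentiable.
  have h := (mulIEquiv n).comp_fderiv (f := V) (x := X)
  exact congrArg (fun f : Mod n →L[ℝ] Mod n ↦ f v) h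

theorem nijenhuis_mulI {n : ℕ} (V W : Mod n → Mod n) (X : Mod n) :
    VectorField.lieBracket ℝ (fun Y ↦ mulI n (V Y)) (fun Y ↦ mulI n (W Y)) X =
      VectorField.lieBracket ℝ V W X +
      mulI n (VectorField.lieBracket ℝ (fun Y ↦ mulI n (V Y)) W X) +
      mulI n (VectorField.lieBracket ℝ V (fun Y ↦ mulI n (W Y)) X) := by
  have hsq : ∀ v, mulI n (mulI n v) = -v := fun v ↦
    congrArg (fun f : Mod n →L[ℝ] Mod n ↦ f v) (mulI_sq n)
  simp only [VectorField.lieBracket_eq, fderiv_mulI_comp, map_sub, hsq]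
  abel

theorem standardHermitian_isKahler (n : ℕ) : (standardHermitian n).IsKahler where
  closed x := by
    rw [TwoForm.ClosedAt, standardHermitian_inChart,
      extDeriv_extDeriv (contDiff_primitiveForm n)
        (by rw [minSmoothness_of_isRCLikeNormedField]; exact WithTop.coe_le_coe.2 (le_top (a := (2 : ℕ∞))))]
    rfl
  nijenhuis V W x _ _ := by
    have hJ : ∀ V : (x : SymSpace n) → TangentSpace 𝓘(ℝ, Mod n) x,
        (fun X : Mod n ↦ toChart x ((extChartAt 𝓘(ℝ, Mod n) x).symm X)
          (mulI n (V ((extChartAt 𝓘(ℝ, Mod n) x).symm X)))) =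
        fun X : Mod n ↦ mulI n (toChart x ((extChartAt 𝓘(ℝ, Mod n) x).symm X)
          (V ((extChartAt 𝓘(ℝ, Mod n) x).symm X))) := fun V ↦
      funext fun X ↦ (mulI_mulLR_apply _ _ _).symm
    have h := nijenhuis_mulI (fun X : Mod n ↦ toChart x ((extChartAt 𝓘(ℝ, Mod n) x).symm X)
          (V ((extChartAt 𝓘(ℝ, Mod n) x).symm X)))
      (fun X : Mod n ↦ toChart x ((extChartAt 𝓘(ℝ, Mod n) x).symm X)
          (W ((extChartAt 𝓘(ℝ, Mod n) x).symm X))) 0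
    rw [← hJ V, ← hJ W] at h
    rw [mlieBracket_eq, mlieBracket_eq, mlieBracket_eq, mlieBracket_eq]
    exact h

end Kahler
-- From invariant skew forms to quaternionic skew-Hermitian forms
section SkewHermitian
open Matrix

/-- The quaternions as complex `2 × 2` matrices. -/
noncomputable def quatMat : ℍ[ℝ] →ₐ[ℝ] Matrix (Fin 2) (Fin 2) ℂ :=
  QuaternionAlgebra.lift
    { i := unitI
      j := unitJ
      k := unitK
      i_mul_i := by rw [unitI_sq]; simp
      j_mul_j := by rw [unitJ_sq]; simp
      i_mul_j := unitI_mul_unitJ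
      j_mul_i := by rw [unitJ_mul_unitI]; simp }

theorem quatMat_apply (q : ℍ[ℝ]) :
    quatMat q = q.re • 1 + q.imI • unitI + q.imJ • unitJ + q.imK • unitK := by
  rw [← Algebra.algebraMap_eq_smul_one]
  rfl

/-- The quaternion with the given components. -/
def quatOf (a b c d : ℝ) : ℍ[ℝ] := ⟨a, b, c, d⟩

@[simp] theorem quatOf_re (a b c d : ℝ) : (quatOf a b c d).re = a := rfl
@[simp] theorem quatOf_imI (a b c d : ℝ) : (quatOf a b c d).imI = b := rfl
@[simp] theorem quatOf_imJ (a b c d : ℝ) : (quatOf a b c d).imJ = c := rfl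
@[simp] theorem quatOf_imK (a b c d : ℝ) : (quatOf a b c d).imK = d := rfl

theorem mem_su2_iff_quatMat {T : Matrix (Fin 2) (Fin 2) ℂ} :
    T ∈ su2 ↔ ∃ q : ℍ[ℝ], q.re = 0 ∧ quatMat q = T := by
  rw [su2_eq_span, Submodule.mem_span_triple]
  constructor
  · rintro ⟨a, b, c, rfl⟩
    refine ⟨quatOf 0 a b c, rfl, ?_⟩
    rw [quatMat_apply]
    simp
  · rintro ⟨q, hq, rfl⟩
    exact ⟨q.imI, q.imJ, q.imK, by rw [quatMat_apply, hq, zero_smul, zero_add]⟩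

/-- The right quaternionic structure on the space of complex `n × 2` matrices. -/
noncomputable def quatAction (n : ℕ) : ℍ[ℝ]ᵐᵒᵖ →ₐ[ℝ] (Mod n →L[ℝ] Mod n) :=
  AlgHom.ofLinearMap
    ((rightMul n).comp (quatMat.toLinearMap.comp (MulOpposite.opLinearEquiv ℝ).symm.toLinearMap))
    (by
      change mulLR 1 (quatMat 1) = 1
      rw [map_one, mulLR_one])
    (fun p q ↦ by
      change mulLR 1 (quatMat (q.unop * p.unop)) = mulLR 1 (quatMat p.unop) * mulLR 1 (quatMat q.unop)
      rw [mulLR_mul, map_mul, Matrix.one_mul])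

theorem quatAction_op {n : ℕ} (q : ℍ[ℝ]) :
    quatAction n (MulOpposite.op q) = rightMul n (quatMat q) := rfl

theorem rightMul_rightMul {n : ℕ} (S T : Matrix (Fin 2) (Fin 2) ℂ) (v : Mod n) :
    rightMul n T (rightMul n S v) = rightMul n (S * T) v := by
  have h := congrArg (fun f : Mod n →L[ℝ] Mod n ↦ f v) (mulLR_mul (n := n) 1 1 T S)
  rw [Matrix.one_mul] at h
  exact h

theorem rightMul_neg_apply {n : ℕ} (T : Matrix (Fin 2) (Fin 2) ℂ) (v : Mod n) :
    rightMul n (-T) v = -rightMul n T v := by rw [map_neg]; rfl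

theorem rightMul_one_apply {n : ℕ} (v : Mod n) : rightMul n 1 v = v :=
  congrArg (fun f : Mod n →L[ℝ] Mod n ↦ f v) mulLR_one

theorem unitJ_mul_unitK : unitJ * unitK = unitI := by
  ext i j; fin_cases i <;> fin_cases j <;> simp [unitI, unitJ, unitK]
theorem unitK_mul_unitJ : unitK * unitJ = -unitI := by
  ext i j; fin_cases i <;> fin_cases j <;> simp [unitI, unitJ, unitK]
theorem unitK_mul_unitI : unitK * unitI = unitJ := by
  ext i j; fin_cases i <;> fin_cases j <;> simp [unitI, unitJ, unitK]
theorem unitI_mul_unitK : unitI * unitK = -unitJ := by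
  ext i j; fin_cases i <;> fin_cases j <;> simp [unitI, unitJ, unitK]

theorem quatAction_apply {n : ℕ} (q : ℍ[ℝ]) (v : Mod n) :
    quatAction n (MulOpposite.op q) v = q.re • v + q.imI • rightMul n unitI v +
      q.imJ • rightMul n unitJ v + q.imK • rightMul n unitK v := by
  rw [quatAction_op, quatMat_apply, map_add, map_add, map_add, map_smul, map_smul, map_smul,
    map_smul]
  change q.re • rightMul n 1 v + q.imI • rightMul n unitI v +
      q.imJ • rightMul n unitJ v + q.imK • rightMul n unitK v = _
  rw [rightMul_one_apply]

/-- The quaternion valued form with real part `β`. -/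
noncomputable def quatForm {n : ℕ} (β : Mod n →ₗ[ℝ] Mod n →ₗ[ℝ] ℝ) :
    Mod n →ₗ[ℝ] Mod n →ₗ[ℝ] ℍ[ℝ] :=
  -- The components are forced: right linearity requires Re(b(v, w) e) = β(v, we), and Re(qe) is
  -- minus the e-component of q for each unit e.
  LinearMap.mk₂ ℝ (fun v w ↦ quatOf (β v w) (-β v (rightMul n unitI w))
      (-β v (rightMul n unitJ w)) (-β v (rightMul n unitK w)))
    (fun v v' w ↦ by ext <;> simp <;> ring)
    (fun c v w ↦ by ext <;> simp)
    (fun v w w' ↦ by ext <;> simp <;> ring)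
    (fun c v w ↦ by ext <;> simp)

theorem quatForm_apply {n : ℕ} (β : Mod n →ₗ[ℝ] Mod n →ₗ[ℝ] ℝ) (v w : Mod n) :
    quatForm β v w = quatOf (β v w) (-β v (rightMul n unitI w)) (-β v (rightMul n unitJ w))
      (-β v (rightMul n unitK w)) := rfl

theorem quatForm_smul_right {n : ℕ} (β : Mod n →ₗ[ℝ] Mod n →ₗ[ℝ] ℝ) (q : ℍ[ℝ]) (v w : Mod n) :
    quatForm β v (quatAction n (MulOpposite.op q) w) = quatForm β v w * q := by
  rw [quatAction_apply]
  simp only [quatForm_apply, map_add, map_smul, rightMul_rightMul, unitI_sq, unitJ_sq, unitK_sq,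
    unitI_mul_unitJ, unitJ_mul_unitI, unitJ_mul_unitK, unitK_mul_unitJ, unitK_mul_unitI,
    unitI_mul_unitK, rightMul_neg_apply, rightMul_one_apply]
  simp only [map_neg, neg_neg]
  ext <;> simp <;> ring

/-- Since T² = −1, invariance and skewness of β make β(·, ·T) symmetric. So the real part is skew
and the three imaginary parts are symmetric, which is skew-Hermitian symmetry. -/
theorem quatForm_skew {n : ℕ} {β : Mod n →ₗ[ℝ] Mod n →ₗ[ℝ] ℝ} (hβ : ∀ v w, β w v = -β v w)
    (hinv : ∀ T, T = unitI ∨ T = unitJ ∨ T = unitK →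
      ∀ v w, β (rightMul n T v) (rightMul n T w) = β v w) (v w : Mod n) :
    quatForm β w v = -star (quatForm β v w) := by
  have h : ∀ T, T = unitI ∨ T = unitJ ∨ T = unitK →
      β w (rightMul n T v) = β v (rightMul n T w) := by
    intro T hT
    have hsq : T * T = -1 := by
      rcases hT with rfl | rfl | rfl
      exacts [unitI_sq, unitJ_sq, unitK_sq]
    have h1 := hinv T hT v (rightMul n T w)
    rw [rightMul_rightMul, hsq, rightMul_neg_apply, rightMul_one_apply, map_neg] at h1
    rw [← h1, hβ]
  simp only [quatForm_apply]
  rw [h unitI (by simp), h unitJ (by simp), h unitK (by simp), hβ v w]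
  ext <;> simp

/-- Conjugate linearity on the left follows from right linearity by exchanging the arguments twice.
-/
theorem quatForm_smul_left {n : ℕ} {β : Mod n →ₗ[ℝ] Mod n →ₗ[ℝ] ℝ} (hβ : ∀ v w, β w v = -β v w)
    (hinv : ∀ T, T = unitI ∨ T = unitJ ∨ T = unitK →
      ∀ v w, β (rightMul n T v) (rightMul n T w) = β v w) (q : ℍ[ℝ]) (v w : Mod n) :
    quatForm β (quatAction n (MulOpposite.op q) v) w = star q * quatForm β v w := by
  rw [quatForm_skew hβ hinv w, quatForm_smul_right, quatForm_skew hβ hinv v w, star_mul, star_neg,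
    star_star, mul_neg, neg_neg]

theorem isRealPartOfSkewHermitian_of_invariant {n : ℕ} {x : SymSpace n}
    (τ : TangentSpace 𝓘(ℝ, Mod n) x [⋀^Fin 2]→L[ℝ] ℝ) (β : Mod n →ₗ[ℝ] Mod n →ₗ[ℝ] ℝ)
    (hτ : ∀ v w : Mod n, τ ![v, w] = β v w) (hβ : ∀ v w, β w v = -β v w)
    (hinv : ∀ T, T = unitI ∨ T = unitJ ∨ T = unitK →
      ∀ v w, β (rightMul n T v) (rightMul n T w) = β v w) :
    IsRealPartOfSkewHermitian (quaternionicStructure n x) τ := by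
  refine ⟨quatAction n, fun A ↦ ?_, quatForm β, quatForm_smul_left hβ hinv,
    quatForm_smul_right β, quatForm_skew hβ hinv, hτ⟩
  rw [quaternionicStructure_eq]
  constructor
  · rintro ⟨T, hT, rfl⟩
    obtain ⟨q, hq, rfl⟩ := mem_su2_iff_quatMat.1 hT
    exact ⟨q, hq, rfl⟩
  · rintro ⟨q, hq, rfl⟩
    exact ⟨quatMat q, mem_su2_iff_quatMat.2 ⟨q, hq, rfl⟩, rfl⟩

end SkewHermitian

namespace AlmostHermitian

/-! ### Pointwise properties of the fundamental form -/

section Fundamental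
variable {E : Type*} [NormedAddCommGroup E] [NormedSpace ℝ E]
  {M : Type*} [TopologicalSpace M] [ChartedSpace E M] [IsManifold 𝓘(ℝ, E) ∞ M]

theorem J_J (h : AlmostHermitian E M) (x : M) (v : TangentSpace 𝓘(ℝ, E) x) :
    h.J x (h.J x v) = -v :=
  congrArg (fun A ↦ A v) (h.sq x)

theorem fundamentalForm_J (h : AlmostHermitian E M) (x : M) (v : TangentSpace 𝓘(ℝ, E) x) :
    h.fundamentalForm x ![v, h.J x v] = h.g.inner x v v := by
  rw [fundamentalForm_apply, J_J, map_neg, neg_neg]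

theorem fundamentalForm_nondegenerate (h : AlmostHermitian E M) (x : M)
    (v : TangentSpace 𝓘(ℝ, E) x) (hv : h.fundamentalForm x ![v, h.J x v] = 0) : v = 0 := by
  by_contra hne
  rw [fundamentalForm_J] at hv
  exact (h.g.pos x v hne).ne' hv

theorem fundamentalForm_swap (h : AlmostHermitian E M) (x : M)
    (v w : TangentSpace 𝓘(ℝ, E) x) :
    h.fundamentalForm x ![w, v] = -h.fundamentalForm x ![v, w] := by
  have h1 := h.hermitian x w (h.J x v)
  rw [J_J, map_neg, h.g.symm] at h1
  rw [fundamentalForm_apply, fundamentalForm_apply, neg_neg, ← h1, neg_neg]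

end Fundamental

/-! ### Arbitrary invariant Kähler structures and the PCS structure -/

section OnSymSpace
open Matrix

variable {n : ℕ} (h : AlmostHermitian (Mod n) (SymSpace n))

/-- The metric at `x`, on matrices. -/
noncomputable def metricAt (x : SymSpace n) : Mod n →L[ℝ] Mod n →L[ℝ] ℝ := h.g.inner x

/-- The complex structure at `x`, on matrices. -/
noncomputable def complexAt (x : SymSpace n) : Mod n →L[ℝ] Mod n := h.J x

/-- The differential of the action at `x`, on matrices. -/
noncomputable def actionAt (a : SU n) (x : SymSpace n) : Mod n →L[ℝ] Mod n :=
  mfderiv 𝓘(ℝ, Mod n) 𝓘(ℝ, Mod n) (fun y : SymSpace n ↦ a • y) x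

/-- The fundamental form at `x` as a bilinear form on matrices. -/
noncomputable def fundamentalBilin (x : SymSpace n) : Mod n →ₗ[ℝ] Mod n →ₗ[ℝ] ℝ :=
  -LinearMap.mk₂ ℝ (fun v w : Mod n ↦ h.metricAt x v (h.complexAt x w))
    (fun v v' w ↦ by rw [map_add]; rfl) (fun c v w ↦ by rw [map_smul]; rfl)
    (fun v w w' ↦ by rw [map_add, map_add]) (fun c v w ↦ by rw [map_smul, map_smul])

theorem fundamentalBilin_apply (x : SymSpace n) (v w : Mod n) :
    h.fundamentalBilin x v w = -h.metricAt x v (h.complexAt x w) := rfl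

/-- Right multiplication by a quaternion unit is the differential at `x` of a group element fixing
`x`, so it preserves g and commutes with J. -/
theorem fundamentalBilin_invariant (hinv : h.IsInvariant (SU n)) (x : SymSpace n)
    {T : Matrix (Fin 2) (Fin 2) ℂ} (hT : T = unitI ∨ T = unitJ ∨ T = unitK) (v w : Mod n) :
    h.fundamentalBilin x (rightMul n T v) (rightMul n T w) = h.fundamentalBilin x v w := by
  obtain ⟨S, -, hS⟩ := exists_unit T hT
  set a := x.out * inclSU2 n S * x.out⁻¹ with ha
  have hs : a • x = x := inclSU2_smul _ S (mk_out x)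
  have hm : actionAt a x = rightMul n T := by
    rw [← hS]; exact isotropyMap_out x S hs
  have h1 : h.metricAt (a • x) (actionAt a x v) (actionAt a x (h.complexAt x w)) =
    h.metricAt x v (h.complexAt x w) := hinv.metric a x v (h.J x w)
  have h2 : h.complexAt (a • x) (actionAt a x w) = actionAt a x (h.complexAt x w) :=
    hinv.complex a x w
  rw [hm, hs] at h1 h2
  rw [fundamentalBilin_apply, fundamentalBilin_apply, h2, h1]

theorem isRealPartOfSkewHermitian (hinv : h.IsInvariant (SU n)) (x : SymSpace n)
    {τ : TangentSpace 𝓘(ℝ, Mod n) x [⋀^Fin 2]→L[ℝ] ℝ}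
    (hτ : τ ∈ Submodule.span ℝ {h.fundamentalForm x}) :
    IsRealPartOfSkewHermitian (quaternionicStructure n x) τ := by
  obtain ⟨c, rfl⟩ := Submodule.mem_span_singleton.1 hτ
  refine isRealPartOfSkewHermitian_of_invariant _ (c • h.fundamentalBilin x) (fun v w ↦ rfl)
    (fun v w ↦ ?_) (fun T hT v w ↦ ?_)
  · have := h.fundamentalForm_swap x v w
    change c • h.fundamentalBilin x w v = -(c • h.fundamentalBilin x v w)
    rw [show h.fundamentalBilin x w v = -h.fundamentalBilin x v w from this, smul_neg]
  · change c • h.fundamentalBilin x _ _ = c • h.fundamentalBilin x v w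
    rw [h.fundamentalBilin_invariant hinv x hT]

/-- The alternating form `(B (v, w) - B (w, v)) / 2`. -/
noncomputable def antisymmetrize (E : Type*) [NormedAddCommGroup E] [NormedSpace ℝ E] :
    (E →L[ℝ] E →L[ℝ] ℝ) →L[ℝ] E [⋀^Fin 2]→L[ℝ] ℝ :=
  (1 / 2 : ℝ) • (ContinuousAlternatingMap.alternatizeUncurryFinCLM ℝ E ℝ (n := 1)).comp
    (ContinuousLinearMap.compL ℝ E (E →L[ℝ] ℝ) (E [⋀^Fin 1]→L[ℝ] ℝ)
      (ContinuousAlternatingMap.ofSubsingletonLIE (𝕜 := ℝ) (E := E) (F := ℝ)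
        (0 : Fin 1)).toContinuousLinearEquiv.toContinuousLinearMap)

theorem antisymmetrize_apply {E : Type*} [NormedAddCommGroup E] [NormedSpace ℝ E]
    (B : E →L[ℝ] E →L[ℝ] ℝ) (u : Fin 2 → E) :
    antisymmetrize E B u = (1 / 2 : ℝ) * (B (u 0) (u 1) - B (u 1) (u 0)) := by
  change (1 / 2 : ℝ) * (ContinuousAlternatingMap.alternatizeUncurryFin _ u) = _
  rw [ContinuousAlternatingMap.alternatizeUncurryFin_apply, Fin.sum_univ_two]
  change (1 / 2 : ℝ) * ((-1 : ℤ) ^ 0 • B (u 0) (u 1) + (-1 : ℤ) ^ 1 • B (u 1) (u 0)) = _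
  simp [sub_eq_add_neg]

theorem contDiffAt_clm_apply {E F H : Type*} [NormedAddCommGroup E] [NormedSpace ℝ E]
    [NormedAddCommGroup F] [NormedSpace ℝ F] [NormedAddCommGroup H] [NormedSpace ℝ H]
    (A : F →L[ℝ] H) {G : E → F} {X : E} (hG : ContDiffAt ℝ ∞ G X) :
    ContDiffAt ℝ ∞ (fun Y ↦ A (G Y)) X :=
  A.contDiff.contDiffAt.comp X hG

set_option synthInstance.maxHeartbeats 400000 in
theorem contDiffAt_antisymmetrize {E : Type*} [NormedAddCommGroup E] [NormedSpace ℝ E]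
    {G : E → E →L[ℝ] E →L[ℝ] ℝ} {K : E → E →L[ℝ] E} {X : E} (hG : ContDiffAt ℝ ∞ G X)
    (hK : ContDiffAt ℝ ∞ K X) :
    ContDiffAt ℝ ∞ (fun Y ↦ antisymmetrize E ((G Y).comp (K Y))) X := by
  -- Composition inserts K into the first argument; with the metric and the complex structure this
  -- is g(Jv, w) = −g(v, Jw), which is ω with the right sign.
  have h1 : ContDiffAt ℝ ∞ (fun Y ↦ (G Y).comp (K Y)) X := hG.clm_comp hK
  exact contDiffAt_clm_apply (antisymmetrize E) h1

/-- The metric in the trivialization of the tangent bundle at `x`. -/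
noncomputable def metricCoord (x z : SymSpace n) : Mod n →L[ℝ] Mod n →L[ℝ] ℝ :=
  (trivializationAt (Mod n →L[ℝ] Mod n →L[ℝ] ℝ) (fun y : SymSpace n ↦
    TangentSpace 𝓘(ℝ, Mod n) y →L[ℝ] TangentSpace 𝓘(ℝ, Mod n) y →L[ℝ] ℝ) x ⟨z, h.g.inner z⟩).2

/-- The complex structure in the trivialization of the tangent bundle at `x`. -/
noncomputable def complexCoord (x z : SymSpace n) : Mod n →L[ℝ] Mod n :=
  (trivializationAt (Mod n →L[ℝ] Mod n) (fun y : SymSpace n ↦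
    TangentSpace 𝓘(ℝ, Mod n) y →L[ℝ] TangentSpace 𝓘(ℝ, Mod n) y) x ⟨z, h.J z⟩).2

theorem metricCoord_apply {x z : SymSpace n} (hz : z ∈ (chartAt (Mod n) x).source) (v w : Mod n) :
    h.metricCoord x z v w = h.metricAt z (fromChart x z v) (fromChart x z w) := by
  have hb : z ∈ (trivializationAt (Mod n) (TangentSpace 𝓘(ℝ, Mod n)) x).baseSet := by
    simpa using hz
  have hsy : ∀ u : Mod n, (trivializationAt (Mod n) (TangentSpace 𝓘(ℝ, Mod n)) x).symm z u =
      fromChart x z u := fun u ↦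
    (Trivialization.symmL_apply (R := ℝ) _ hb u).symm.trans
      (congrArg (fun f : Mod n →L[ℝ] Mod n ↦ f u) (symmL_eq hz))
  rw [metricCoord, hom_trivializationAt_apply, inCoordinates_apply_eq₂ hb hb (Set.mem_univ _), hsy,
    hsy]
  simp
  rfl

theorem metricCoord_comm {x z : SymSpace n} (hz : z ∈ (chartAt (Mod n) x).source) (v w : Mod n) :
    h.metricCoord x z v w = h.metricCoord x z w v := by
  rw [metricCoord_apply h hz, metricCoord_apply h hz]
  exact h.g.symm z _ _

theorem fromChart_complexCoord {x z : SymSpace n} (hz : z ∈ (chartAt (Mod n) x).source)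
    (w : Mod n) : fromChart x z (h.complexCoord x z w) = h.complexAt z (fromChart x z w) := by
  have h1 : h.complexCoord x z = (toChart x z).comp ((h.complexAt z).comp (fromChart x z)) := by
    rw [complexCoord, hom_trivializationAt_apply]
    change (ContinuousLinearMap.comp _ (ContinuousLinearMap.comp _ _)) = _
    rw [continuousLinearMapAt_eq hz, symmL_eq hz]
    rfl
  rw [h1]
  exact congrArg (fun f : Mod n →L[ℝ] Mod n ↦ f (h.complexAt z (fromChart x z w)))
    (fromChart_mul_toChart hz)

theorem contDiffAt_comp_chart_symm {F : Type*} [NormedAddCommGroup F] [NormedSpace ℝ F]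
    {f : SymSpace n → F} {x : SymSpace n} (hf : ContMDiffAt 𝓘(ℝ, Mod n) 𝓘(ℝ, F) ∞ f x) :
    ContDiffAt ℝ ∞ (fun X ↦ f ((extChartAt 𝓘(ℝ, Mod n) x).symm X))
      (extChartAt 𝓘(ℝ, Mod n) x x) := by
  have h1 : ContMDiffAt 𝓘(ℝ, Mod n) 𝓘(ℝ, Mod n) ∞ (extChartAt 𝓘(ℝ, Mod n) x).symm
      (extChartAt 𝓘(ℝ, Mod n) x x) :=
    (contMDiffOn_extChartAt_symm x).contMDiffAt
      (by rw [extChartAt_target_eq]; exact Filter.univ_mem)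
  exact (ContMDiffAt.comp_of_eq hf h1 (extChartAt_to_inv x)).contDiffAt

theorem contDiffAt_metricCoord (x : SymSpace n) :
    ContDiffAt ℝ ∞ (fun X ↦ h.metricCoord x ((extChartAt 𝓘(ℝ, Mod n) x).symm X))
      (extChartAt 𝓘(ℝ, Mod n) x x) := by
  have h1 := (contMDiffAt_section x).1 (h.g.contMDiff x)
  exact contDiffAt_comp_chart_symm (f := h.metricCoord x) h1

theorem contDiffAt_complexCoord (x : SymSpace n) :
    ContDiffAt ℝ ∞ (fun X ↦ h.complexCoord x ((extChartAt 𝓘(ℝ, Mod n) x).symm X))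
      (extChartAt 𝓘(ℝ, Mod n) x x) := by
  have h1 := (contMDiffAt_section x).1 (h.smooth x)
  exact contDiffAt_comp_chart_symm (f := h.complexCoord x) h1

theorem fundamentalForm_inChart_apply (x : SymSpace n) (X : Mod n) (u : Fin 2 → Mod n) :
    h.fundamentalForm.inChart x X u =
      -h.metricCoord x ((extChartAt 𝓘(ℝ, Mod n) x).symm X) (u 0)
        (h.complexCoord x ((extChartAt 𝓘(ℝ, Mod n) x).symm X) (u 1)) := by
  set z := (extChartAt 𝓘(ℝ, Mod n) x).symm X with hz
  have hzs : z ∈ (chartAt (Mod n) x).source := extChartAt_symm_mem x X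
  have hzX : X = extChartAt 𝓘(ℝ, Mod n) x z :=
    ((extChartAt 𝓘(ℝ, Mod n) x).right_inv (by rw [extChartAt_target_eq]; trivial)).symm
  have hm := mfderiv_chart_symm hzs
  rw [← hzX] at hm
  rw [metricCoord_apply h hzs, fromChart_complexCoord h hzs, TwoForm.inChart, hm]
  rfl

/-- The coordinate form takes values in alternating maps, whereas g and J give smooth bilinear maps.
The continuous linear projection `antisymmetrize` links the two, and it does not change ω, which is
already skew. -/
theorem fundamentalForm_smoothAt (x : SymSpace n) : h.fundamentalForm.SmoothAt x := by
  refine (contDiffAt_antisymmetrize (h.contDiffAt_metricCoord x)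
    (h.contDiffAt_complexCoord x)).congr_of_eventuallyEq (Filter.Eventually.of_forall fun X ↦ ?_)
  refine ContinuousAlternatingMap.ext fun u ↦ ?_
  rw [antisymmetrize_apply]
  have h0 := h.fundamentalForm_inChart_apply x X u
  have h1 := h.fundamentalForm_inChart_apply x X (u ∘ Equiv.swap 0 1)
  have h2 := (h.fundamentalForm.inChart x X).toAlternatingMap.map_swap u
    (show (0 : Fin 2) ≠ 1 by decide)
  have h3 : h.fundamentalForm.inChart x X (u ∘ Equiv.swap 0 1) =
    -h.fundamentalForm.inChart x X u := h2
  rw [h3] at h1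
  have e0 : (u ∘ Equiv.swap 0 1) 0 = u 1 := by simp
  have e1 : (u ∘ Equiv.swap 0 1) 1 = u 0 := by simp
  rw [e0, e1] at h1
  rw [metricCoord_comm h (extChartAt_symm_mem x X)] at h0 h1
  change _ = (1 / 2 : ℝ) *
    (h.metricCoord x ((extChartAt 𝓘(ℝ, Mod n) x).symm X)
        (h.complexCoord x ((extChartAt 𝓘(ℝ, Mod n) x).symm X) (u 0)) (u 1) -
      h.metricCoord x ((extChartAt 𝓘(ℝ, Mod n) x).symm X)
        (h.complexCoord x ((extChartAt 𝓘(ℝ, Mod n) x).symm X) (u 1)) (u 0))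
  linarith

theorem isPCS (hn : 2 ≤ n) (hk : h.IsKahler) (hinv : h.IsInvariant (SU n)) :
    IsPCSOfQuaternionicType (quaternionicStructure n)
      (fun x ↦ Submodule.span ℝ {h.fundamentalForm x}) where
  dimension := ⟨n, hn, by
    rw [Module.finrank_pi_fintype]
    simp [Module.finrank_pi_fintype, Complex.finrank_real_complex]
    ring⟩
  almostQuaternionic := isAlmostQuaternionic n
  conformallySymplectic :=
    have hne : ∀ y, h.fundamentalForm y ≠ 0 := fun y h0 ↦ by
      -- Positivity excludes ω = 0 once a nonzero tangent vector exists; the all-ones matrix is one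
      -- because n > 0.
      have h1 : (fun _ _ ↦ 1 : Mod n) = 0 := h.fundamentalForm_nondegenerate y
        (fun _ _ ↦ 1 : Mod n) (by rw [h0]; rfl)
      exact one_ne_zero (congrFun (congrFun h1 ⟨0, by omega⟩) 0)
    { smooth_line := fun x ↦ ⟨Set.univ, isOpen_univ, trivial, h.fundamentalForm,
        fun y _ ↦ ⟨h.fundamentalForm_smoothAt y, hne y, rfl⟩⟩
      nondegenerate := fun x τ hτ hτ0 v hv ↦ by
        obtain ⟨c, rfl⟩ := Submodule.mem_span_singleton.1 hτ
        have hc : c ≠ 0 := fun hc ↦ hτ0 (by rw [hc, zero_smul])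
        have h1 : c * h.fundamentalForm x ![v, h.J x v] = 0 := hv (h.J x v)
        exact h.fundamentalForm_nondegenerate x v ((mul_eq_zero.1 h1).resolve_left hc)
      closed_section := fun x ↦ ⟨Set.univ, isOpen_univ, trivial, h.fundamentalForm, hne x,
        fun y _ ↦ ⟨Submodule.mem_span_singleton_self _, h.fundamentalForm_smoothAt y,
          hk.closed y⟩⟩ }
  skewHermitian x _ hτ _ := h.isRealPartOfSkewHermitian hinv x hτ

end OnSymSpace
end AlmostHermitian
end QuatPCS

theorem corollary3p4 (n : ℕ) (hn : 2 ≤ n) :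
    (QuatPCS.IsAlmostQuaternionic (QuatPCS.quaternionicStructure n) ∧
      QuatPCS.IsInvariantEndFamily (QuatPCS.SU n) (QuatPCS.quaternionicStructure n)) ∧
    (∃ h : QuatPCS.AlmostHermitian (QuatPCS.Mod n) (QuatPCS.SymSpace n),
      h.IsKahler ∧ h.IsInvariant (QuatPCS.SU n)) ∧
    ∀ h : QuatPCS.AlmostHermitian (QuatPCS.Mod n) (QuatPCS.SymSpace n),
      h.IsKahler → h.IsInvariant (QuatPCS.SU n) →
        QuatPCS.IsPCSOfQuaternionicType (QuatPCS.quaternionicStructure n)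
          (fun x ↦ Submodule.span ℝ {h.fundamentalForm x}) :=
  ⟨⟨QuatPCS.isAlmostQuaternionic n, QuatPCS.isInvariant_quaternionicStructure n⟩,
    ⟨QuatPCS.standardHermitian n, QuatPCS.standardHermitian_isKahler n,
      QuatPCS.standardHermitian_isInvariant n⟩,
    fun h hk hinv ↦ h.isPCS hn hk hinv⟩
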